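/- Let $r\ge 1$. For $\epsilon>0$ let $\mathcal C$ be the Hankel contour: the positive real axis from $+\infty$ to $\epsilon$ (top side, argument $0$), the circle of radius $\epsilon$ around $0$ (counterclockwise), and the positive real axis from $\epsilon$ to $+\infty$ (bottom side, argument $2\pi$), with $\epsilon$ sufficiently small (depending only on $r$); powers $x^{s-1}$ on $\mathcal C$ are taken with $\arg x$ running from $0$ to $2\pi$. For $\mathbf s=(s_1,\dots,s_r)\in(\mathbb C\setminus\mathbb Z)^r$ put $C(\mathbf s)=\prod_{k=1}^r\frac{1}{(e^{2\pi i s_k}-1)\Gamma(s_k)}$, and for $x_1,\dots,x_r\in\mathcal C$ put $y_j=x_j+\cdots+x_r$. The desingularized multiple zeta function $\zeta^{\mathrm{des}}_r$ is the entire continuation to $\mathbb C^r$ of $$\zeta^{\mathrm{des}}_r(\mathbf s)=\lim_{c\to1,\;c\in\mathbb R\setminus\{1\}}\frac{C(\mathbf s)}{(1-c)^r}\int_{\mathcal C^r}\prod_{j=1}^r\Bigl(\frac1{e^{y_j}-1}-\frac{c}{e^{cy_j}-1}\Bigr)\prod_{k=1}^r x_k^{s_k-1}\,dx_k\qquad(\mathbf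 s\in(\mathbb C\setminus\mathbb Z)^r).$$ For $t\in(0,1)$, the function $\mathbf s\mapsto\hat\zeta^{\mathrm{des}}_r(\mathbf s)(t)$ is the entire continuation to $\mathbb C^r$ of $$\hat\zeta^{\mathrm{des}}_r(\mathbf s)(t)=C(\mathbf s)\int_{\mathcal C^r}\prod_{j=1}^r\Bigl(\frac1{\frac1te^{y_j}-1}+\frac{(\log t-y_j)\frac1te^{y_j}}{(\frac1te^{y_j}-1)^2}\Bigr)\prod_{k=1}^r x_k^{s_k-1}\,dx_k\qquad(\mathbf s\in(\mathbb C\setminus\mathbb Z)^r).$$ For functions $f$ on $(0,1)$ put $J[f](t)=\int_0^t f(z)\frac{dz}{z}$ and $D[f](t)=t\,f'(t)$, and write $J^{-1}=D$, so that $J^k$ is defined for all $k\in\mathbb Z$. Put $L^{\mathrm{des}}(0)(t)=\frac{t}{1-t}+\frac{t\log t}{(1-t)^2}$ and, for $k_1,\dots,k_r\in\mathbb Z$, $$L^{\mathrm{des}}(k_1,\dots,k_r)=J^{k_r}\Bigl[L^{\mathrm{des}}(0)\,J^{k_{r-1}}\bigl[L^{\mathrm{des}}(0)\cdots J^{k_1}[L^{\mathrm{des}}(0)]\cdots\bigr]\Bigr].$$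 Theorem. All these objects are well defined: the contour integrals converge absolutely (for $\zeta^{\mathrm{des}}_r$, for all real $c\neq1$ close enough to $1$), the limit for $c\to1$ and the entire continuations exist and do not depend on the choice of the sufficiently small $\epsilon$, and every $L^{\mathrm{des}}(k_1,\dots,k_r)$ is differentiable on $(0,1)$ and integrable against $dz/z$ on $(0,t)$ for every $t\in(0,1)$. For all $k_1,\dots,k_r\in\mathbb Z$ and all $t\in(0,1)$, $$\hat\zeta^{\mathrm{des}}_r(k_1,\dots,k_r)(t)=L^{\mathrm{des}}(k_1,\dots,k_r)(t).$$ Consequently, $$\lim_{t\to1-0}L^{\mathrm{des}}(k_1,\dots,k_r)(t)=\zeta^{\mathrm{des}}_r(k_1,\dots,k_r).$$ -/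

import Mathlib

open Filter Topology MeasureTheory

noncomputable section

/-! ### The Hankel contour

The contour comes from `+∞` along the upper side of the positive real axis to `ε`, runs once
counterclockwise around the circle of radius `ε`, and goes back to `+∞` along the lower side.
It is parametrized by `u ∈ ℝ`: incoming ray for `u < 0`, circle for `0 ≤ u ≤ 2π`, outgoing ray for
`2π < u`. -/

/-- The absolute value of the point of the contour with parameter `u`. -/
def hankelRadius (ε u : ℝ) : ℝ :=
  if u < 0 then ε - u else if u ≤ 2 * Real.pi then ε else ε + (u - 2 * Real.pi)

/-- The argument of the point of the contour with parameter `u`; it grows continuously from `0`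
to `2π`. -/
def hankelArg (u : ℝ) : ℝ :=
  if u < 0 then 0 else if u ≤ 2 * Real.pi then u else 2 * Real.pi

/-- The point of the contour with parameter `u`. -/
def hankelPath (ε u : ℝ) : ℂ :=
  (hankelRadius ε u : ℂ) * Complex.exp (Complex.I * (hankelArg u : ℂ))

/-- The velocity of the contour (its derivative in `u`, except at the two corners
`u = 0, 2π`, see `hasDerivAt_hankelPath`). -/
def hankelVel (ε u : ℝ) : ℂ :=
  if u < 0 then -1
  else if u ≤ 2 * Real.pi then Complex.I * (ε : ℂ) * Complex.exp (Complex.I * (u : ℂ))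
  else 1

theorem hasDerivAt_hankelPath (ε u : ℝ) (h₀ : u ≠ 0) (h₁ : u ≠ 2 * Real.pi) :
    HasDerivAt (hankelPath ε) (hankelVel ε u) u := by
  have hpi := Real.pi_pos
  rcases lt_or_gt_of_ne h₀ with h | h
  · have e : hankelPath ε =ᶠ[𝓝 u] fun v : ℝ => (ε : ℂ) - (v : ℂ) := by
      filter_upwards [Iio_mem_nhds h] with v hv
      have hv' : v < 0 := hv
      change hankelPath ε v = _
      simp [hankelPath, hankelRadius, hankelArg, hv']
    have d : HasDerivAt (fun v : ℝ => (ε : ℂ) - (v : ℂ)) (-1) u :=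
      (Complex.ofRealCLM.hasDerivAt (x := u)).const_sub (ε : ℂ)
    simpa [hankelVel, h] using d.congr_of_eventuallyEq e
  · rcases lt_or_gt_of_ne h₁ with h' | h'
    · have e : hankelPath ε =ᶠ[𝓝 u]
          fun v : ℝ => (ε : ℂ) * Complex.exp (Complex.I * (v : ℂ)) := by
        filter_upwards [Ioo_mem_nhds h h'] with v hv
        have hv0 : ¬ v < 0 := not_lt.2 hv.1.le
        have hv1 : v ≤ 2 * Real.pi := hv.2.le
        simp [hankelPath, hankelRadius, hankelArg, hv0, hv1]
      have d : HasDerivAt (fun v : ℝ => (ε : ℂ) * Complex.exp (Complex.I * (v : ℂ)))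
          ((ε : ℂ) * (Complex.exp (Complex.I * (u : ℂ)) * (Complex.I * 1))) u :=
        (((Complex.ofRealCLM.hasDerivAt (x := u)).const_mul Complex.I).cexp).const_mul (ε : ℂ)
      refine (d.congr_of_eventuallyEq e).congr_deriv ?_
      simp only [hankelVel, not_lt.2 h.le, h'.le, if_true, if_false]
      ring
    · have e : hankelPath ε =ᶠ[𝓝 u] fun v : ℝ => (ε : ℂ) + ((v : ℂ) - 2 * Real.pi) := by
        filter_upwards [Ioi_mem_nhds h'] with v hv
        have hv' : 2 * Real.pi < v := hv
        have hv0 : ¬ v < 0 := by linarith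
        have hx : Complex.exp (Complex.I * (2 * (Real.pi : ℂ))) = 1 := by
          rw [mul_comm]; exact Complex.exp_two_pi_mul_I
        simp [hankelPath, hankelRadius, hankelArg, hv0, not_le.2 hv', hx]
      have d : HasDerivAt (fun v : ℝ => (ε : ℂ) + ((v : ℂ) - 2 * Real.pi)) 1 u :=
        ((Complex.ofRealCLM.hasDerivAt (x := u)).sub_const (2 * Real.pi : ℂ)).const_add (ε : ℂ)
      refine (d.congr_of_eventuallyEq e).congr_deriv ?_
      simp [hankelVel, not_lt.2 h.le, not_le.2 h']

/-- The power `x ^ a` at the point `x` of the contour with parameter `u`, for the branch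
`log x = log |x| + i arg x` with `arg x` running from `0` to `2π` along the contour. -/
def hankelPow (ε : ℝ) (a : ℂ) (u : ℝ) : ℂ :=
  Complex.exp (a * ((Real.log (hankelRadius ε u) : ℂ) + Complex.I * (hankelArg u : ℂ)))

/-- The integrand of the `r`-fold contour integral of `Φ(x₁,…,x_r) ∏ x_k ^ (s_k - 1) dx_k`
in the parameters `(u₁,…,u_r) ∈ ℝ^r`. -/
def hankelIntegrand {r : ℕ} (Φ : (Fin r → ℂ) → ℂ) (ε : ℝ) (s : Fin r → ℂ) (u : Fin r → ℝ) : ℂ :=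
  Φ (fun k => hankelPath ε (u k)) * ∏ k, (hankelPow ε (s k - 1) (u k) * hankelVel ε (u k))

/-- The `r`-fold contour integral of `Φ(x₁,…,x_r) ∏ x_k ^ (s_k - 1) dx_k`. -/
def hankelIntegral {r : ℕ} (Φ : (Fin r → ℂ) → ℂ) (ε : ℝ) (s : Fin r → ℂ) : ℂ :=
  ∫ u : Fin r → ℝ, hankelIntegrand Φ ε s u

/-- `C(s) = ∏ 1 / ((e^{2πi s_k} - 1) Γ(s_k))`. -/
def hankelCoeff {r : ℕ} (s : Fin r → ℂ) : ℂ :=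
  ∏ k, 1 / ((Complex.exp (2 * Real.pi * Complex.I * s k) - 1) * Complex.Gamma (s k))

/-- All coordinates of `s` lie in `ℂ \ ℤ`. -/
def NonIntegral {r : ℕ} (s : Fin r → ℂ) : Prop :=
  ∀ k, ∀ n : ℤ, s k ≠ (n : ℂ)

/-! ### The desingularized multiple zeta function -/

/-- The generating function `∏_j (1 / (e^{y_j} - 1) - c / (e^{c y_j} - 1))`, where
`y_j = x_j + ⋯ + x_r`. -/
def desKernel (r : ℕ) (c : ℝ) (x : Fin r → ℂ) : ℂ :=
  ∏ j, (1 / (Complex.exp (∑ k ∈ Finset.Ici j, x k) - 1)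
    - (c : ℂ) / (Complex.exp ((c : ℂ) * ∑ k ∈ Finset.Ici j, x k) - 1))

/-- `Z` is the entire continuation to `ℂ^r` of the function defined on `(ℂ \ ℤ)^r` as the limit
for `c → 1`, `c ≠ 1`, of `(1 - c)^{-r} C(s) ∫ desKernel(x; c) ∏ x_k ^ (s_k - 1) dx_k` over the
Hankel contour of any sufficiently small radius. -/
def IsZetaDes (r : ℕ) (Z : (Fin r → ℂ) → ℂ) : Prop :=
  Differentiable ℂ Z ∧
  ∃ ε₀ > 0, ∀ ε ∈ Set.Ioo (0 : ℝ) ε₀, ∀ s : Fin r → ℂ, NonIntegral s →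
    (∀ᶠ c : ℝ in 𝓝[≠] 1, Integrable (hankelIntegrand (desKernel r c) ε s)) ∧
    Tendsto
      (fun c : ℝ => 1 / (1 - (c : ℂ)) ^ r * hankelCoeff s * hankelIntegral (desKernel r c) ε s)
      (𝓝[≠] 1) (𝓝 (Z s))

/-- The desingularized multiple zeta function `ζ_r^des` on `ℂ^r`. -/
def zetaDes (r : ℕ) : (Fin r → ℂ) → ℂ :=
  Classical.epsilon (IsZetaDes r)

/-! ### The one-parameter version -/

/-- The kernel
`∏_j (1 / (t⁻¹ e^{y_j} - 1) + (log t - y_j) t⁻¹ e^{y_j} / (t⁻¹ e^{y_j} - 1)²)`, where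
`y_j = x_j + ⋯ + x_r`. -/
def hatKernel (r : ℕ) (t : ℝ) (x : Fin r → ℂ) : ℂ :=
  ∏ j, (1 / (1 / (t : ℂ) * Complex.exp (∑ k ∈ Finset.Ici j, x k) - 1)
    + ((Real.log t : ℂ) - ∑ k ∈ Finset.Ici j, x k)
        * (1 / (t : ℂ) * Complex.exp (∑ k ∈ Finset.Ici j, x k))
        / (1 / (t : ℂ) * Complex.exp (∑ k ∈ Finset.Ici j, x k) - 1) ^ 2)

/-- For every `t ∈ (0,1)`, the function `F t` is the entire continuation to `ℂ^r` of the function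
`C(s) ∫ hatKernel(x; t) ∏ x_k ^ (s_k - 1) dx_k` on `(ℂ \ ℤ)^r`, with the integral over the Hankel
contour of any sufficiently small radius (how small does not depend on `t`). -/
def IsHatZetaDes (r : ℕ) (F : ℝ → (Fin r → ℂ) → ℂ) : Prop :=
  (∀ t ∈ Set.Ioo (0 : ℝ) 1, Differentiable ℂ (F t)) ∧
  ∃ ε₀ > 0, ∀ ε ∈ Set.Ioo (0 : ℝ) ε₀, ∀ t ∈ Set.Ioo (0 : ℝ) 1, ∀ s : Fin r → ℂ, NonIntegral s →
    Integrable (hankelIntegrand (hatKernel r t) ε s) ∧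
    F t s = hankelCoeff s * hankelIntegral (hatKernel r t) ε s

/-- The function `(t, s) ↦ \hat ζ_r^des(s)(t)` for `t ∈ (0,1)` and `s ∈ ℂ^r`. -/
def hatZetaDes (r : ℕ) : ℝ → (Fin r → ℂ) → ℂ :=
  Classical.epsilon (IsHatZetaDes r)

/-! ### The iterated integrals -/

/-- `J[f](t) = ∫_0^t f(z) dz / z`. -/
def opJ (f : ℝ → ℝ) (t : ℝ) : ℝ := ∫ z in (0 : ℝ)..t, f z / z

/-- `D[f](t) = t f'(t)`. -/
def opD (f : ℝ → ℝ) (t : ℝ) : ℝ := t * deriv f t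

/-- `J^k` for `k ∈ ℤ`, where `J^{-1} = D`. -/
def opJPow : ℤ → (ℝ → ℝ) → (ℝ → ℝ)
  | Int.ofNat n => opJ^[n]
  | Int.negSucc n => opD^[n + 1]

/-- `L^des(0)(t) = t / (1 - t) + t log t / (1 - t)²`. -/
def desLiZero (t : ℝ) : ℝ := t / (1 - t) + t * Real.log t / (1 - t) ^ 2

/-- `L^des(k₁,…,k_r) = J^{k_r}[L^des(0) J^{k_{r-1}}[L^des(0) ⋯ J^{k₁}[L^des(0)] ⋯ ]]`, as a
function on `(0,1)`. -/
def desLi : (r : ℕ) → (Fin r → ℤ) → ℝ → ℝ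
  | 0, _ => fun _ => 1
  | r + 1, k =>
      opJPow (k (Fin.last r)) (fun t => desLiZero t * desLi r (fun i => k i.castSucc) t)

end

/-!
Since `e^{-log t + y} = e^y / t`, in the coordinate `w = -log t` every factor of the kernel of
`ζ̂^des` is the value at `w + y_j` of one function, the derivative of the Bernoulli generating
function `w / (e^w - 1)`, which is holomorphic for `|Im w| < 2π` and decays exponentially to the
right. Hence the contour integral is an iterated one: starting from `1`, one
alternately multiplies by this function and applies the normalized transform
`T_s f (w) = Γ(1-s) e^{-πis} / (2πi) ∫_C f(w+x) x^{s-1} dx`. This transform satisfies `T_0 f = f`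
and, by integration by parts, `(T_{s+1} f)' = -T_s f`. Since `D` is `-d/dw` in the coordinate `w`,
and `J` its inverse on functions that vanish at `t = 0`, `T_k` is `J^k` for every integer `k`.

The factor `Γ(1-s)` has poles at the positive integers. For `Re s > 0` the contour collapses onto
the positive axis and `T_s f (w) = Γ(s)⁻¹ ∫_0^∞ f(w+x) x^{s-1} dx`, so that choosing the contour for
`Re s < 1` and the axis otherwise makes the iterated transform entire in `s`. The normalized kernel
of `ζ^des` is a difference quotient converging, under a uniform exponential bound, to the kernel of
`ζ̂^des` at `w = 0`, that is, at `t = 1`; as the iterated transform is continuous at `w = 0`, so is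
the limit of `L^des`.
-/

section ParametricIntegrals

variable {α 𝕜 E H : Type*} [MeasurableSpace α] {μ : Measure α}
  [NormedAddCommGroup E] [NormedAddCommGroup H]

theorem integrable_exp_neg_mul_abs {b : ℝ} (hb : 0 < b) :
    Integrable fun u : ℝ => Real.exp (-b * |u|) := by
  refine Integrable.of_integral_ne_zero ?_
  rw [integral_comp_abs (f := fun u => Real.exp (-b * u)), integral_exp_mul_Ioi (neg_neg_of_pos hb)]
  simpa using hb.ne'

theorem norm_fderiv_le_of_forall_norm_le [NormedSpace ℂ E] [NormedSpace ℂ H] {f : E → H} {x : E}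
    {R C : ℝ} (hR : 0 < R) (hf : DifferentiableOn ℂ f (Metric.ball x R))
    (hC : ∀ y ∈ Metric.ball x R, ‖f y‖ ≤ C) : ‖fderiv ℂ f x‖ ≤ 2 * C / R := by
  refine Complex.norm_fderiv_le_div_of_mapsTo_ball hf (fun y hy => ?_) hR
  rw [mem_closedBall_iff_norm]
  linarith [norm_sub_le (f y) (f x), hC y hy, hC x (Metric.mem_ball_self hR)]

theorem aestronglyMeasurable_fderiv_apply [NontriviallyNormedField 𝕜] [NormedSpace 𝕜 E]
    [NormedSpace 𝕜 H] {F : E → α → H} {s₀ : E}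
    (hmeas : ∀ᶠ s in 𝓝 s₀, AEStronglyMeasurable (F s) μ)
    (hdiff : ∀ a, DifferentiableAt 𝕜 (fun s => F s a) s₀) (e : E) :
    AEStronglyMeasurable (fun a => fderiv 𝕜 (fun s => F s a) s₀ e) μ := by
  obtain ⟨c, hc⟩ := NormedField.exists_one_lt_norm 𝕜
  have hcn : Tendsto (fun n : ℕ => ‖c ^ n‖) atTop atTop := by
    simpa only [norm_pow] using tendsto_pow_atTop_atTop_of_one_lt hc
  have hsteps : Tendsto (fun n : ℕ => s₀ + (c ^ n)⁻¹ • e) atTop (𝓝 s₀) := by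
    have h0 : Tendsto (fun n : ℕ => (c ^ n)⁻¹) atTop (𝓝 0) :=
      tendsto_inv₀_cobounded.comp (tendsto_norm_atTop_iff_cobounded.1 hcn)
    simpa using (h0.smul_const e).const_add s₀
  obtain ⟨N, hN⟩ := eventually_atTop.1 (hsteps.eventually hmeas)
  refine aestronglyMeasurable_of_tendsto_ae atTop
    (f := fun n a => c ^ (n + N) • (F (s₀ + (c ^ (n + N))⁻¹ • e) a - F s₀ a))
    (fun n => ((hN _ (Nat.le_add_left _ _)).sub hmeas.self_of_nhds).const_smul _)
    (ae_of_all _ fun a => ?_)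
  exact (hdiff a).hasFDerivAt.lim e (hcn.comp (tendsto_add_atTop_nat N))

theorem aestronglyMeasurable_fderiv_of_finiteDimensional [NontriviallyNormedField 𝕜]
    [CompleteSpace 𝕜] [NormedSpace 𝕜 E] [FiniteDimensional 𝕜 E] [NormedSpace 𝕜 H]
    {F : E → α → H} {s₀ : E} (hmeas : ∀ᶠ s in 𝓝 s₀, AEStronglyMeasurable (F s) μ)
    (hdiff : ∀ a, DifferentiableAt 𝕜 (fun s => F s a) s₀) :
    AEStronglyMeasurable (fun a => fderiv 𝕜 (fun s => F s a) s₀) μ := by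
  let b := Module.finBasis 𝕜 E
  have hcoord : (fun a => fderiv 𝕜 (fun s => F s a) s₀) = fun a => ∑ i,
      ContinuousLinearMap.smulRightL 𝕜 E H (b.coord i).toContinuousLinearMap
        (fderiv 𝕜 (fun s => F s a) s₀ (b i)) := by
    ext a x
    conv_lhs => rw [← b.sum_repr x, map_sum]
    simp
  rw [hcoord]
  exact Finset.aestronglyMeasurable_fun_sum _ fun i _ =>
    (ContinuousLinearMap.continuous _).comp_aestronglyMeasurable
      (aestronglyMeasurable_fderiv_apply hmeas hdiff (b i))

theorem differentiableAt_integral_of_norm_le [NormedSpace ℂ E] [FiniteDimensional ℂ E]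
    [NormedSpace ℂ H] {F : E → α → H} {s₀ : E} {ρ : ℝ} (hρ : 0 < ρ) {bound : α → ℝ}
    (hmeas : ∀ s ∈ Metric.ball s₀ ρ, AEStronglyMeasurable (F s) μ)
    (hle : ∀ s ∈ Metric.ball s₀ ρ, ∀ a, ‖F s a‖ ≤ bound a) (hint : Integrable bound μ)
    (hdiff : ∀ a, DifferentiableOn ℂ (fun s => F s a) (Metric.ball s₀ ρ)) :
    DifferentiableAt ℂ (fun s => ∫ a, F s a ∂μ) s₀ := by
  have hs₀ : s₀ ∈ Metric.ball s₀ ρ := Metric.mem_ball_self hρ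
  have hat : ∀ a, ∀ s ∈ Metric.ball s₀ ρ, DifferentiableAt ℂ (fun s => F s a) s := fun a s hs =>
    (hdiff a s hs).differentiableAt (Metric.isOpen_ball.mem_nhds hs)
  have hnhds : ∀ᶠ s in 𝓝 s₀, AEStronglyMeasurable (F s) μ := by
    filter_upwards [Metric.ball_mem_nhds s₀ hρ] with s hs using hmeas s hs
  refine (hasFDerivAt_integral_of_dominated_of_fderiv_le (bound := fun a => 2 * bound a / (ρ / 2))
    (Metric.ball_mem_nhds s₀ (half_pos hρ)) hnhds
    (hint.mono' (hmeas _ hs₀) (ae_of_all _ (hle _ hs₀)))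
    (aestronglyMeasurable_fderiv_of_finiteDimensional hnhds fun a => hat a s₀ hs₀)
    (ae_of_all _ fun a s hs => ?_) ((hint.const_mul 2).div_const _)
    (ae_of_all _ fun a s hs =>
      (hat a s (Metric.ball_subset_ball (by linarith) hs)).hasFDerivAt)).differentiableAt
  have hsub : Metric.ball s (ρ / 2) ⊆ Metric.ball s₀ ρ :=
    Metric.ball_subset_ball' (by linarith [Metric.mem_ball.1 hs])
  exact norm_fderiv_le_of_forall_norm_le (half_pos hρ) ((hdiff a).mono hsub)
    fun y hy => hle y (hsub hy) a

end ParametricIntegrals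

section HalfStrip

/-- The half strip `{-δ < Re w, |Im w| < δ}`, a neighbourhood of the ray `[0, ∞)`. -/
def halfStrip (δ : ℝ) : Set ℂ := {w | -δ < w.re ∧ |w.im| < δ}

variable {δ δ' ε : ℝ} {w x : ℂ}

theorem isOpen_halfStrip (δ : ℝ) : IsOpen (halfStrip δ) :=
  (isOpen_lt continuous_const Complex.continuous_re).inter
    (isOpen_lt Complex.continuous_im.abs continuous_const)

theorem halfStrip_mono (h : δ ≤ δ') : halfStrip δ ⊆ halfStrip δ' := fun _ hw =>
  ⟨by linarith [hw.1], hw.2.trans_le h⟩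

theorem add_mem_halfStrip (hw : w ∈ halfStrip (δ - ε)) (hre : -ε ≤ x.re) (him : |x.im| ≤ ε) :
    w + x ∈ halfStrip δ :=
  ⟨by rw [Complex.add_re]; linarith [hw.1],
    by rw [Complex.add_im]; linarith [hw.2, abs_add_le w.im x.im]⟩

theorem ofReal_mem_halfStrip {a : ℝ} (hδ : 0 < δ) (ha : 0 ≤ a) : (a : ℂ) ∈ halfStrip δ :=
  ⟨by simpa using by linarith, by simpa using hδ⟩

theorem zero_mem_halfStrip (hδ : 0 < δ) : (0 : ℂ) ∈ halfStrip δ :=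
  ofReal_mem_halfStrip hδ le_rfl

theorem ball_subset_halfStrip (hw : w ∈ halfStrip (δ - ε)) : Metric.ball w ε ⊆ halfStrip δ := by
  intro z hz
  have hz' : ‖z - w‖ ≤ ε := (mem_ball_iff_norm.1 hz).le
  simpa using add_mem_halfStrip (x := z - w) hw
    (abs_le.1 ((Complex.abs_re_le_norm _).trans hz')).1 ((Complex.abs_im_le_norm _).trans hz')

theorem exists_pos_mem_halfStrip_sub (hw : w ∈ halfStrip δ) : ∃ η > 0, w ∈ halfStrip (δ - η) := by
  have hpos : 0 < min (δ + w.re) (δ - |w.im|) :=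
    lt_min (by linarith [hw.1]) (by linarith [hw.2])
  refine ⟨_, half_pos hpos, ?_, ?_⟩
  · linarith [min_le_left (δ + w.re) (δ - |w.im|)]
  · linarith [min_le_right (δ + w.re) (δ - |w.im|)]

end HalfStrip

section Decay

/-- `f` is bounded by `M * exp (-β Re w)` on the half strip of width `δ`. -/
def ExpBoundOn (β M δ : ℝ) (f : ℂ → ℂ) : Prop :=
  ∀ w ∈ halfStrip δ, ‖f w‖ ≤ M * Real.exp (-(β * w.re))

/-- Holomorphic functions of exponential decay on a half strip: the functions to which the integral
transforms along the contours are applied. -/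
structure IsDecaying (δ : ℝ) (f : ℂ → ℂ) : Prop where
  differentiableOn : DifferentiableOn ℂ f (halfStrip δ)
  exists_expBoundOn : ∃ β > 0, ∃ M, ExpBoundOn β M δ f

variable {β M δ δ' η : ℝ} {f g : ℂ → ℂ} {w : ℂ}

theorem ExpBoundOn.mono (hf : ExpBoundOn β M δ f) (h : δ' ≤ δ) : ExpBoundOn β M δ' f :=
  fun w hw => hf w (halfStrip_mono h hw)

theorem ExpBoundOn.nonneg (hf : ExpBoundOn β M δ f) (hw : w ∈ halfStrip δ) : 0 ≤ M :=
  nonneg_of_mul_nonneg_left ((norm_nonneg _).trans (hf w hw)) (Real.exp_pos _)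

theorem ExpBoundOn.norm_le_of_le_re (hf : ExpBoundOn β M δ f) (hβ : 0 ≤ β) (hw : w ∈ halfStrip δ)
    {x : ℝ} (hx : x ≤ w.re) : ‖f w‖ ≤ M * Real.exp (-(β * x)) := by
  have hM := hf.nonneg hw
  exact (hf w hw).trans (by gcongr)

theorem ExpBoundOn.norm_le (hf : ExpBoundOn β M δ f) (hβ : 0 ≤ β) (hw : w ∈ halfStrip δ) :
    ‖f w‖ ≤ M * Real.exp (β * δ) := by
  simpa using hf.norm_le_of_le_re hβ hw hw.1.le

namespace IsDecaying

theorem mono (hf : IsDecaying δ f) (h : δ' ≤ δ) : IsDecaying δ' f where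
  differentiableOn := hf.differentiableOn.mono (halfStrip_mono h)
  exists_expBoundOn := by
    obtain ⟨β, hβ, M, hM⟩ := hf.exists_expBoundOn
    exact ⟨β, hβ, M, hM.mono h⟩

theorem congr (hf : IsDecaying δ f) (h : Set.EqOn g f (halfStrip δ)) : IsDecaying δ g where
  differentiableOn := hf.differentiableOn.congr h
  exists_expBoundOn := by
    obtain ⟨β, hβ, M, hM⟩ := hf.exists_expBoundOn
    exact ⟨β, hβ, M, fun w hw => (h hw).symm ▸ hM w hw⟩

theorem exists_norm_le (hf : IsDecaying δ f) : ∃ B, ∀ w ∈ halfStrip δ, ‖f w‖ ≤ B := by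
  obtain ⟨β, hβ, M, hM⟩ := hf.exists_expBoundOn
  exact ⟨M * Real.exp (β * δ), fun w hw => hM.norm_le hβ.le hw⟩

theorem mul_of_norm_le {B : ℝ} (hf : IsDecaying δ f) (hg : DifferentiableOn ℂ g (halfStrip δ))
    (hB : ∀ w ∈ halfStrip δ, ‖g w‖ ≤ B) : IsDecaying δ fun w => f w * g w where
  differentiableOn := hf.differentiableOn.mul hg
  exists_expBoundOn := by
    obtain ⟨β, hβ, M, hM⟩ := hf.exists_expBoundOn
    refine ⟨β, hβ, M * B, fun w hw => ?_⟩
    rw [norm_mul, mul_right_comm]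
    exact mul_le_mul (hM w hw) (hB w hw) (norm_nonneg _) ((norm_nonneg _).trans (hM w hw))

theorem differentiableAt (hf : IsDecaying δ f) (hw : w ∈ halfStrip δ) : DifferentiableAt ℂ f w :=
  hf.differentiableOn.differentiableAt ((isOpen_halfStrip δ).mem_nhds hw)

theorem deriv (hf : IsDecaying δ f) (hη : 0 < η) : IsDecaying (δ - η) (deriv f) where
  differentiableOn :=
    (hf.differentiableOn.deriv (isOpen_halfStrip δ)).mono (halfStrip_mono (by linarith))
  exists_expBoundOn := by
    obtain ⟨β, hβ, M, hM⟩ := hf.exists_expBoundOn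
    refine ⟨β, hβ, 2 * (M * Real.exp (β * η)) / η, fun w hw => ?_⟩
    have hsub := ball_subset_halfStrip hw
    have hball : ∀ z ∈ Metric.ball w η, ‖f z‖ ≤ M * Real.exp (-(β * (w.re - η))) := by
      intro z hz
      have hre := (abs_le.1 ((Complex.abs_re_le_norm _).trans (mem_ball_iff_norm.1 hz).le)).1
      rw [Complex.sub_re] at hre
      exact hM.norm_le_of_le_re hβ.le (hsub hz) (by linarith)
    rw [norm_deriv_eq_norm_fderiv]
    calc _ ≤ 2 * (M * Real.exp (-(β * (w.re - η)))) / η :=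
          norm_fderiv_le_of_forall_norm_le hη (hf.differentiableOn.mono hsub) hball
      _ = _ := by
          rw [show -(β * (w.re - η)) = β * η + -(β * w.re) by ring, Real.exp_add]
          ring

end IsDecaying

end Decay

section WeightedPaths

/-- A path in the closed half strip `{-ε ≤ Re x, |Im x| ≤ ε}`. -/
structure IsNearRay (ε : ℝ) (p : ℝ → ℂ) : Prop where
  continuous : Continuous p
  neg_le_re : ∀ u, -ε ≤ (p u).re
  abs_im_le : ∀ u, |(p u).im| ≤ ε

/-- A path near the ray `[0, ∞)` together with a weight `κ` against which every function that
decays exponentially along the path can be integrated. -/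
structure IsWeightedPath (ε : ℝ) (p κ : ℝ → ℂ) : Prop extends IsNearRay ε p where
  measurable_weight : Measurable κ
  exists_weight_le : ∀ β > 0, ∃ C b, 0 < b ∧
    ∀ u, ‖κ u‖ * Real.exp (-(β * (p u).re)) ≤ C * Real.exp (-b * |u|)

/-- The transform `w ↦ ∫ f (w + x) κ` along the path `x = p u`. -/
noncomputable def pathTransform (p κ : ℝ → ℂ) (f : ℂ → ℂ) (w : ℂ) : ℂ := ∫ u, f (w + p u) * κ u

variable {β M δ ε ε' C b : ℝ} {p κ : ℝ → ℂ} {f : ℂ → ℂ} {w : ℂ}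

theorem IsNearRay.nonneg (hp : IsNearRay ε p) : 0 ≤ ε := (abs_nonneg _).trans (hp.abs_im_le 0)

theorem IsNearRay.add_mem (hp : IsNearRay ε p) (hw : w ∈ halfStrip (δ - ε)) (u : ℝ) :
    w + p u ∈ halfStrip δ :=
  add_mem_halfStrip hw (hp.neg_le_re u) (hp.abs_im_le u)

theorem IsNearRay.mono (hp : IsNearRay ε p) (h : ε ≤ ε') : IsNearRay ε' p where
  continuous := hp.continuous
  neg_le_re u := by linarith [hp.neg_le_re u]
  abs_im_le u := (hp.abs_im_le u).trans h

theorem IsWeightedPath.mono (hp : IsWeightedPath ε p κ) (h : ε ≤ ε') : IsWeightedPath ε' p κ where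
  toIsNearRay := hp.toIsNearRay.mono h
  measurable_weight := hp.measurable_weight
  exists_weight_le := hp.exists_weight_le

theorem ExpBoundOn.norm_comp_add_mul_le (hf : ExpBoundOn β M δ f) (hp : IsNearRay ε p) {u : ℝ}
    (hκ : ‖κ u‖ * Real.exp (-(β * (p u).re)) ≤ C * Real.exp (-b * |u|))
    (hw : w ∈ halfStrip (δ - ε)) :
    ‖f (w + p u) * κ u‖ ≤ M * Real.exp (-(β * w.re)) * (C * Real.exp (-b * |u|)) := by
  have hmem := hp.add_mem hw u
  have hM := hf.nonneg hmem
  calc ‖f (w + p u) * κ u‖ ≤ M * Real.exp (-(β * (w + p u).re)) * ‖κ u‖ := by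
        rw [norm_mul]
        exact mul_le_mul_of_nonneg_right (hf _ hmem) (norm_nonneg _)
    _ = M * Real.exp (-(β * w.re)) * (‖κ u‖ * Real.exp (-(β * (p u).re))) := by
        rw [Complex.add_re, mul_add, neg_add, Real.exp_add]
        ring
    _ ≤ _ := by gcongr

namespace IsDecaying

theorem aestronglyMeasurable_comp_add_mul (hf : IsDecaying δ f) (hp : IsWeightedPath ε p κ)
    (hw : w ∈ halfStrip (δ - ε)) : AEStronglyMeasurable fun u => f (w + p u) * κ u := by
  have hcont : Continuous fun u => f (w + p u) :=
    hf.differentiableOn.continuousOn.comp_continuous (continuous_const.add hp.continuous)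
      (hp.add_mem hw)
  exact (hcont.measurable.mul hp.measurable_weight).aestronglyMeasurable

theorem integrable_comp_add_mul (hf : IsDecaying δ f) (hp : IsWeightedPath ε p κ)
    (hw : w ∈ halfStrip (δ - ε)) : Integrable fun u => f (w + p u) * κ u := by
  obtain ⟨β, hβ, M, hM⟩ := hf.exists_expBoundOn
  obtain ⟨C, b, hb, hC⟩ := hp.exists_weight_le β hβ
  exact (((integrable_exp_neg_mul_abs hb).const_mul C).const_mul _).mono'
    (hf.aestronglyMeasurable_comp_add_mul hp hw)
    (ae_of_all _ fun u => hM.norm_comp_add_mul_le hp.toIsNearRay (hC u) hw)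

theorem hasDerivAt_pathTransform (hf : IsDecaying δ f) (hp : IsWeightedPath ε p κ)
    (hw : w ∈ halfStrip (δ - ε)) :
    HasDerivAt (pathTransform p κ f) (pathTransform p κ (_root_.deriv f) w) w := by
  obtain ⟨η, hη, hwη⟩ := exists_pos_mem_halfStrip_sub hw
  rw [sub_right_comm] at hwη
  have hf' := hf.deriv hη
  obtain ⟨β, hβ, M, hM⟩ := hf'.exists_expBoundOn
  obtain ⟨C, b, hb, hC⟩ := hp.exists_weight_le β hβ
  have hnhds := (isOpen_halfStrip (δ - η - ε)).mem_nhds hwη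
  have hsub : halfStrip (δ - η - ε) ⊆ halfStrip (δ - ε) := halfStrip_mono (by linarith)
  have hM0 := hM.nonneg (hp.add_mem hwη 0)
  have hC0 : 0 ≤ C := nonneg_of_mul_nonneg_left
    ((mul_nonneg (norm_nonneg _) (Real.exp_pos _).le).trans (hC 0)) (Real.exp_pos _)
  refine (hasDerivAt_integral_of_dominated_loc_of_deriv_le
    (F := fun z u => f (z + p u) * κ u) (F' := fun z u => _root_.deriv f (z + p u) * κ u)
    (bound := fun u => M * Real.exp (-(β * -(δ - η - ε))) * (C * Real.exp (-b * |u|)))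
    hnhds ?_ (hf.integrable_comp_add_mul hp hw) (hf'.aestronglyMeasurable_comp_add_mul hp hwη)
    (ae_of_all _ fun u z hz => ?_) (((integrable_exp_neg_mul_abs hb).const_mul C).const_mul _)
    (ae_of_all _ fun u z hz => ?_)).2
  · filter_upwards [hnhds] with z hz using hf.aestronglyMeasurable_comp_add_mul hp (hsub hz)
  · have hre := hz.1
    exact (hM.norm_comp_add_mul_le hp.toIsNearRay (hC u) hz).trans (by gcongr)
  · exact ((hf.differentiableAt (hp.add_mem (hsub hz) u)).hasDerivAt.comp_add_const z
      (p u)).mul_const _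

theorem pathTransform (hf : IsDecaying δ f) (hp : IsWeightedPath ε p κ) :
    IsDecaying (δ - ε) (pathTransform p κ f) where
  differentiableOn _ hw :=
    (hf.hasDerivAt_pathTransform hp hw).differentiableAt.differentiableWithinAt
  exists_expBoundOn := by
    obtain ⟨β, hβ, M, hM⟩ := hf.exists_expBoundOn
    obtain ⟨C, b, hb, hC⟩ := hp.exists_weight_le β hβ
    refine ⟨β, hβ, M * ∫ u, C * Real.exp (-b * |u|), fun w hw => ?_⟩
    calc _ ≤ ∫ u, M * Real.exp (-(β * w.re)) * (C * Real.exp (-b * |u|)) :=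
          norm_integral_le_of_norm_le (((integrable_exp_neg_mul_abs hb).const_mul C).const_mul _)
            (ae_of_all _ fun u => hM.norm_comp_add_mul_le hp.toIsNearRay (hC u) hw)
      _ = _ := by rw [integral_const_mul]; ring

end IsDecaying

end WeightedPaths

section NestedIntegrals

/-- The integrand `∏_j G(a + p_j(u_j) + ⋯ + p_r(u_r)) ∏_k κ_k(u_k)`; the kernels of the contour
integrals have this shape. -/
noncomputable def nestedIntegrand {r : ℕ} (G : ℂ → ℂ) (p κ : Fin r → ℝ → ℂ) (a : ℂ)
    (u : Fin r → ℝ) : ℂ :=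
  (∏ j, G (a + ∑ k ∈ Finset.Ici j, p k (u k))) * ∏ k, κ k (u k)

/-- The integral of `nestedIntegrand` over `ℝ^r`. -/
noncomputable def nestedIntegral {r : ℕ} (G : ℂ → ℂ) (p κ : Fin r → ℝ → ℂ) (a : ℂ) : ℂ :=
  ∫ u, nestedIntegrand G p κ a u

theorem sum_Ici_castSucc {M : Type*} [AddCommMonoid M] {r : ℕ} (x : Fin (r + 1) → M) (j : Fin r) :
    ∑ k ∈ Finset.Ici j.castSucc, x k = x (Fin.last r) + ∑ k ∈ Finset.Ici j, x k.castSucc := by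
  have h₁ : Finset.Ici j.castSucc = Finset.univ.filter (j.castSucc ≤ ·) := by ext; simp
  have h₂ : Finset.Ici j = Finset.univ.filter (j ≤ ·) := by ext; simp
  rw [h₁, h₂, Finset.sum_filter, Finset.sum_filter, Fin.sum_univ_castSucc]
  simp [Fin.le_last, add_comm]

theorem prod_sum_Ici_succ {M N : Type*} [AddCommMonoid M] [CommMonoid N] (G : M → N) {r : ℕ}
    (x : Fin (r + 1) → M) (a : M) :
    ∏ j, G (a + ∑ k ∈ Finset.Ici j, x k) =
      G (a + x (Fin.last r)) *
        ∏ j : Fin r, G (a + x (Fin.last r) + ∑ k ∈ Finset.Ici j, x k.castSucc) := by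
  have hlast : Finset.Ici (Fin.last r) = {Fin.last r} := by ext; simp [Fin.last_le_iff]
  rw [Fin.prod_univ_castSucc, hlast, Finset.sum_singleton, mul_comm]
  simp only [sum_Ici_castSucc, add_assoc]

theorem sub_natCast_succ_mul (δ ε : ℝ) (r : ℕ) : δ - (r + 1 : ℕ) * ε = δ - r * ε - ε := by
  push_cast
  ring

theorem ae_pi_of_forall_ae_insertNth {n : ℕ} (j : Fin (n + 1)) {P : (Fin (n + 1) → ℝ) → Prop}
    (hP : MeasurableSet {u | P u}) (h : ∀ y : Fin n → ℝ, ∀ᵐ v : ℝ, P (j.insertNth v y)) :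
    ∀ᵐ u, P u := by
  have e := (volume_preserving_piFinSuccAbove (fun _ : Fin (n + 1) => ℝ) j).symm
  have hprod : ∀ᵐ x : ℝ × (Fin n → ℝ), P (j.insertNth x.1 x.2) := by
    have hmeas : MeasurableSet {x : ℝ × (Fin n → ℝ) | P (j.insertNth x.1 x.2)} := e.measurable hP
    rw [Measure.volume_eq_prod, Measure.ae_prod_iff_ae_ae hmeas]
    exact (Measure.ae_ae_comm (p := fun v y => P (j.insertNth v y)) hmeas).2 (ae_of_all _ h)
  rw [← e.map_eq, ae_map_iff e.aemeasurable hP]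
  exact hprod

variable {β M δ ε : ℝ} {r : ℕ} {G : ℂ → ℂ} {a : ℂ}

section

variable {p κ : Fin r → ℝ → ℂ}

theorem add_sum_mem_halfStrip (hp : ∀ k, IsNearRay ε (p k)) (ha : a ∈ halfStrip (δ - r * ε))
    (t : Finset (Fin r)) (u : Fin r → ℝ) : a + ∑ k ∈ t, p k (u k) ∈ halfStrip δ := by
  have hcard : ∑ _k ∈ t, ε ≤ r * ε := by
    simpa using Finset.sum_le_sum_of_subset_of_nonneg (f := fun _ => ε) (Finset.subset_univ t)
      fun k _ _ => (hp k).nonneg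
  refine add_mem_halfStrip ha ?_ ?_
  · rw [Complex.re_sum]
    have := Finset.sum_le_sum (s := t) fun k _ => (hp k).neg_le_re (u k)
    rw [Finset.sum_neg_distrib] at this
    linarith
  · rw [Complex.im_sum]
    exact (Finset.abs_sum_le_sum_abs _ _).trans
      ((Finset.sum_le_sum fun k _ => (hp k).abs_im_le (u k)).trans hcard)

theorem norm_nestedIntegrand_le (hβ : 0 ≤ β) (hG : ExpBoundOn β M δ G)
    (hp : ∀ k, IsNearRay ε (p k)) {C b : Fin r → ℝ} {u : Fin r → ℝ}
    (hκ : ∀ k, ‖κ k (u k)‖ * Real.exp (-(β * (p k (u k)).re)) ≤ C k * Real.exp (-b k * |u k|))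
    (ha : a ∈ halfStrip (δ - r * ε)) :
    ‖nestedIntegrand G p κ a u‖ ≤
      ∏ k, M * Real.exp (β * δ) * (C k * Real.exp (-b k * |u k|)) := by
  rw [nestedIntegrand, norm_mul, norm_prod, norm_prod, ← Finset.prod_mul_distrib]
  refine Finset.prod_le_prod (fun k _ => by positivity) fun j _ => ?_
  have hmem := add_sum_mem_halfStrip hp ha (Finset.Ici j) u
  have hM := hG.nonneg hmem
  have htail := (add_sum_mem_halfStrip hp ha (Finset.Ioi j) u).1
  have hre : (p j (u j)).re - δ ≤ (a + ∑ k ∈ Finset.Ici j, p k (u k)).re := by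
    rw [Finset.Ici_eq_cons_Ioi, Finset.sum_cons, add_left_comm, Complex.add_re]
    linarith
  calc _ ≤ M * Real.exp (-(β * ((p j (u j)).re - δ))) * ‖κ j (u j)‖ := by
        gcongr
        exact hG.norm_le_of_le_re hβ hmem hre
    _ = M * Real.exp (β * δ) * (‖κ j (u j)‖ * Real.exp (-(β * (p j (u j)).re))) := by
        rw [show -(β * ((p j (u j)).re - δ)) = β * δ + -(β * (p j (u j)).re) by ring,
          Real.exp_add]
        ring
    _ ≤ _ := mul_le_mul_of_nonneg_left (hκ j) (by positivity)

theorem integrable_prod_exp_neg_mul_abs (C : Fin r → ℝ) {b : Fin r → ℝ} (hb : ∀ k, 0 < b k)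
    (K : ℝ) : Integrable fun u : Fin r → ℝ => ∏ k, K * (C k * Real.exp (-b k * |u k|)) :=
  Integrable.fintype_prod (f := fun k x => K * (C k * Real.exp (-b k * |x|))) fun k =>
    ((integrable_exp_neg_mul_abs (hb k)).const_mul _).const_mul _

theorem IsDecaying.aestronglyMeasurable_nestedIntegrand (hG : IsDecaying δ G)
    (hp : ∀ k, IsNearRay ε (p k)) (hκ : ∀ k, Measurable (κ k))
    (ha : a ∈ halfStrip (δ - r * ε)) : AEStronglyMeasurable (nestedIntegrand G p κ a) := by
  have hcont : Continuous fun u : Fin r → ℝ => ∏ j, G (a + ∑ k ∈ Finset.Ici j, p k (u k)) := by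
    refine continuous_finsetProd _ fun j _ =>
      hG.differentiableOn.continuousOn.comp_continuous ?_ (add_sum_mem_halfStrip hp ha _)
    exact continuous_const.add (continuous_finsetSum _ fun k _ =>
      (hp k).continuous.comp (continuous_apply k))
  exact (hcont.measurable.mul (Finset.measurable_prod _ fun k _ =>
    (hκ k).comp (measurable_pi_apply k))).aestronglyMeasurable

theorem IsDecaying.integrable_nestedIntegrand (hG : IsDecaying δ G)
    (hp : ∀ k, IsWeightedPath ε (p k) (κ k)) (ha : a ∈ halfStrip (δ - r * ε)) :
    Integrable (nestedIntegrand G p κ a) := by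
  obtain ⟨β, hβ, M, hM⟩ := hG.exists_expBoundOn
  choose C b hb hC using fun k => (hp k).exists_weight_le β hβ
  exact (integrable_prod_exp_neg_mul_abs C hb _).mono'
    (hG.aestronglyMeasurable_nestedIntegrand (fun k => (hp k).toIsNearRay)
      (fun k => (hp k).measurable_weight) ha)
    (ae_of_all _ fun u => norm_nestedIntegrand_le hβ.le hM (fun k => (hp k).toIsNearRay)
      (fun k => hC k (u k)) ha)

theorem ae_add_sum_Ici_ne_zero (hp : ∀ k, Continuous (p k)) (hne : ∀ k z, ∀ᵐ u, p k u ≠ z)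
    (a : ℂ) (j : Fin r) : ∀ᵐ u : Fin r → ℝ, a + ∑ k ∈ Finset.Ici j, p k (u k) ≠ 0 := by
  obtain ⟨n, rfl⟩ : ∃ n, r = n + 1 := ⟨r - 1, by have := j.pos; omega⟩
  have hcont : Continuous fun u : Fin (n + 1) → ℝ => a + ∑ k ∈ Finset.Ici j, p k (u k) :=
    continuous_const.add (continuous_finsetSum _ fun k _ => (hp k).comp (continuous_apply k))
  refine ae_pi_of_forall_ae_insertNth j (isOpen_ne_fun hcont continuous_const).measurableSet
    fun y => ?_
  have htail : ∀ v, ∑ k ∈ Finset.Ioi j, p k (j.insertNth (α := fun _ => ℝ) v y k) =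
      ∑ k ∈ Finset.Ioi j, p k (j.insertNth (α := fun _ => ℝ) 0 y k) := fun v => by
    refine Finset.sum_congr rfl fun k hk => ?_
    obtain ⟨i, rfl⟩ := Fin.exists_succAbove_eq (Finset.mem_Ioi.1 hk).ne'
    simp only [Fin.insertNth_apply_succAbove]
  filter_upwards [hne j (-(a + ∑ k ∈ Finset.Ioi j, p k (j.insertNth (α := fun _ => ℝ) 0 y k)))]
    with v hv h₀
  rw [Finset.Ici_eq_cons_Ioi, Finset.sum_cons, htail, Fin.insertNth_apply_same,
    add_left_comm] at h₀
  exact hv (eq_neg_of_add_eq_zero_left h₀)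

end

theorem nestedIntegral_zero (G : ℂ → ℂ) (p κ : Fin 0 → ℝ → ℂ) (a : ℂ) :
    nestedIntegral G p κ a = 1 := by
  simp [nestedIntegral, nestedIntegrand, volume_pi, measureReal_def]

theorem IsDecaying.nestedIntegral_succ {p κ : Fin (r + 1) → ℝ → ℂ} (hG : IsDecaying δ G)
    (hp : ∀ k, IsWeightedPath ε (p k) (κ k)) (ha : a ∈ halfStrip (δ - (r + 1 : ℕ) * ε)) :
    nestedIntegral G p κ a = _root_.pathTransform (p (Fin.last r)) (κ (Fin.last r)) (fun w => G w *
      nestedIntegral G (fun k : Fin r => p k.castSucc) (fun k => κ k.castSucc) w) a := by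
  have e := (volume_preserving_piFinSuccAbove (fun _ : Fin (r + 1) => ℝ) (Fin.last r)).symm
  have hint := hG.integrable_nestedIntegrand hp ha
  rw [← e.integrable_comp_emb (MeasurableEquiv.measurableEmbedding _), Measure.volume_eq_prod]
    at hint
  rw [nestedIntegral, ← e.integral_comp (MeasurableEquiv.measurableEmbedding _),
    Measure.volume_eq_prod]
  refine (integral_prod _ hint).trans (integral_congr_ae (ae_of_all _ fun v => ?_))
  simp only [nestedIntegral]
  rw [← integral_const_mul, ← integral_mul_const]
  refine integral_congr_ae (ae_of_all _ fun y => ?_)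
  let x := (MeasurableEquiv.piFinSuccAbove (fun _ : Fin (r + 1) => ℝ) (Fin.last r)).symm (v, y)
  have hlast : x (Fin.last r) = v := by
    simp [x, MeasurableEquiv.piFinSuccAbove_symm_apply, Fin.insertNthEquiv]
  have hcast : ∀ k : Fin r, x k.castSucc = y k := fun k => by
    simp [x, MeasurableEquiv.piFinSuccAbove_symm_apply, Fin.insertNthEquiv]
  change nestedIntegrand G p κ a x = _
  simp only [nestedIntegrand]
  rw [prod_sum_Ici_succ G (fun k => p k (x k)), Fin.prod_univ_castSucc]
  simp only [hlast, hcast]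
  ring

variable {p κ : Fin r → ℝ → ℂ}

theorem IsDecaying.mul_nestedIntegral (hG : IsDecaying δ G)
    (hp : ∀ k, IsWeightedPath ε (p k) (κ k)) :
    IsDecaying (δ - r * ε) fun w => G w * nestedIntegral G p κ w := by
  induction r with
  | zero =>
    simp only [nestedIntegral_zero, mul_one]
    exact hG.mono (by simp)
  | succ r ih =>
    have hT := (ih fun k => hp k.castSucc).pathTransform (hp (Fin.last r))
    rw [← sub_natCast_succ_mul] at hT
    have heq : Set.EqOn (nestedIntegral G p κ) _ (halfStrip (δ - (r + 1 : ℕ) * ε)) :=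
      fun a ha => hG.nestedIntegral_succ hp ha
    obtain ⟨B, hB⟩ := hT.exists_norm_le
    have hle : δ - (r + 1 : ℕ) * ε ≤ δ :=
      sub_le_self _ (mul_nonneg (Nat.cast_nonneg _) (hp 0).nonneg)
    exact (hG.mono hle).mul_of_norm_le (hT.differentiableOn.congr heq) fun w hw => heq hw ▸ hB w hw

theorem IsDecaying.continuousAt_nestedIntegral (hG : IsDecaying δ G)
    (hp : ∀ k, IsWeightedPath ε (p k) (κ k)) (ha : a ∈ halfStrip (δ - r * ε)) :
    ContinuousAt (nestedIntegral G p κ) a := by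
  cases r with
  | zero =>
    rw [funext (nestedIntegral_zero G p κ)]
    exact continuousAt_const
  | succ r =>
    have hT := (hG.mul_nestedIntegral fun k => hp k.castSucc).pathTransform (hp (Fin.last r))
    rw [← sub_natCast_succ_mul] at hT
    have heq : Set.EqOn (nestedIntegral G p κ) _ (halfStrip (δ - (r + 1 : ℕ) * ε)) :=
      fun a ha => hG.nestedIntegral_succ hp ha
    exact (hT.differentiableOn.congr heq).continuousOn.continuousAt
      ((isOpen_halfStrip _).mem_nhds ha)

theorem IsDecaying.nestedIntegral_congr (hG : IsDecaying δ G) {p' κ' : Fin r → ℝ → ℂ}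
    (hp : ∀ k, IsWeightedPath ε (p k) (κ k)) (hp' : ∀ k, IsWeightedPath ε (p' k) (κ' k))
    (heq : ∀ k δ f, IsDecaying δ f →
      Set.EqOn (_root_.pathTransform (p k) (κ k) f) (_root_.pathTransform (p' k) (κ' k) f)
        (halfStrip (δ - ε)))
    (ha : a ∈ halfStrip (δ - r * ε)) : nestedIntegral G p κ a = nestedIntegral G p' κ' a := by
  induction r generalizing a with
  | zero => simp [nestedIntegral_zero]
  | succ r ih =>
    have ha' := sub_natCast_succ_mul δ ε r ▸ ha
    rw [hG.nestedIntegral_succ hp ha, hG.nestedIntegral_succ hp' ha,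
      ← heq _ _ _ (hG.mul_nestedIntegral fun k => hp' k.castSucc) ha']
    refine integral_congr_ae (ae_of_all _ fun u => ?_)
    simp only [ih (fun _ => hp _) (fun _ => hp' _) (fun _ => heq _) ((hp _).add_mem ha' u)]

end NestedIntegrals

section HolomorphicWeights

/-- A family `κ s` of weights on a path that depends holomorphically on the parameter `s` near
`s₀`, with bounds that are uniform near `s₀`. -/
structure IsHolomorphicWeightAt (ε : ℝ) (p : ℝ → ℂ) (κ : ℂ → ℝ → ℂ) (s₀ : ℂ) : Prop
    extends IsNearRay ε p where
  eventually_measurable : ∀ᶠ s in 𝓝 s₀, Measurable (κ s)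
  eventually_differentiableAt : ∀ᶠ s in 𝓝 s₀, ∀ u, DifferentiableAt ℂ (fun z => κ z u) s
  exists_eventually_le : ∀ β > 0, ∃ C b, 0 < b ∧ ∀ᶠ s in 𝓝 s₀, ∀ u,
    ‖κ s u‖ * Real.exp (-(β * (p u).re)) ≤ C * Real.exp (-b * |u|)

variable {ε : ℝ}

theorem IsHolomorphicWeightAt.isWeightedPath {p : ℝ → ℂ} {κ : ℂ → ℝ → ℂ} {s₀ : ℂ}
    (hp : IsHolomorphicWeightAt ε p κ s₀) : IsWeightedPath ε p (κ s₀) where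
  toIsNearRay := hp.toIsNearRay
  measurable_weight := hp.eventually_measurable.self_of_nhds
  exists_weight_le β hβ := by
    obtain ⟨C, b, hb, hC⟩ := hp.exists_eventually_le β hβ
    exact ⟨C, b, hb, hC.self_of_nhds⟩

theorem IsHolomorphicWeightAt.const_mul {p : ℝ → ℂ} {κ : ℂ → ℝ → ℂ} {c : ℂ → ℂ} {s₀ : ℂ}
    (hp : IsHolomorphicWeightAt ε p κ s₀) (hc : ∀ᶠ s in 𝓝 s₀, DifferentiableAt ℂ c s) :
    IsHolomorphicWeightAt ε p (fun s u => c s * κ s u) s₀ where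
  toIsNearRay := hp.toIsNearRay
  eventually_measurable := hp.eventually_measurable.mono fun _ hs => hs.const_mul _
  eventually_differentiableAt := by
    filter_upwards [hc, hp.eventually_differentiableAt] with s hcs hκs u using hcs.mul (hκs u)
  exists_eventually_le β hβ := by
    obtain ⟨C, b, hb, hC⟩ := hp.exists_eventually_le β hβ
    have hc_le : ∀ᶠ s in 𝓝 s₀, ‖c s‖ ≤ ‖c s₀‖ + 1 :=
      (hc.self_of_nhds.continuousAt.norm.eventually_lt_const (lt_add_one _)).mono fun _ => le_of_lt
    refine ⟨(‖c s₀‖ + 1) * C, b, hb, ?_⟩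
    filter_upwards [hc_le, hC] with s hcs hκs u
    rw [norm_mul, mul_assoc, mul_assoc]
    exact mul_le_mul hcs (hκs u) (by positivity) (by positivity)

theorem IsDecaying.differentiableAt_nestedIntegral {δ : ℝ} {r : ℕ} {G : ℂ → ℂ} {a : ℂ}
    {p : Fin r → ℝ → ℂ} {κ : Fin r → ℂ → ℝ → ℂ} {s₀ : Fin r → ℂ} (hG : IsDecaying δ G)
    (hp : ∀ k, IsHolomorphicWeightAt ε (p k) (κ k) (s₀ k)) (ha : a ∈ halfStrip (δ - r * ε)) :
    DifferentiableAt ℂ (fun s => nestedIntegral G p (fun k => κ k (s k)) a) s₀ := by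
  obtain ⟨β, hβ, M, hM⟩ := hG.exists_expBoundOn
  choose C b hb hC using fun k => (hp k).exists_eventually_le β hβ
  have hnhds : ∀ᶠ s in 𝓝 s₀, ∀ k, Measurable (κ k (s k)) ∧
      (∀ u, DifferentiableAt ℂ (fun z => κ k z u) (s k)) ∧
      ∀ u, ‖κ k (s k) u‖ * Real.exp (-(β * (p k u).re)) ≤ C k * Real.exp (-b k * |u|) :=
    eventually_all.2 fun k => (continuous_apply k).continuousAt.eventually
      ((hp k).eventually_measurable.and ((hp k).eventually_differentiableAt.and (hC k)))
  obtain ⟨ρ, hρ, hball⟩ := Metric.eventually_nhds_iff_ball.1 hnhds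
  refine differentiableAt_integral_of_norm_le hρ
    (fun s hs => hG.aestronglyMeasurable_nestedIntegrand (fun k => (hp k).toIsNearRay)
      (fun k => (hball s hs k).1) ha)
    (fun s hs u => norm_nestedIntegrand_le hβ.le hM (fun k => (hp k).toIsNearRay)
      (fun k => (hball s hs k).2.2 (u k)) ha)
    (integrable_prod_exp_neg_mul_abs C hb _) fun u s hs => ?_
  have hfactor : ∀ k, DifferentiableAt ℂ (fun s : Fin r → ℂ => κ k (s k) (u k)) s := fun k =>
    DifferentiableAt.comp (g := fun z => κ k z (u k)) s ((hball s hs k).2.1 (u k))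
      (differentiableAt_apply k s)
  have hprod := HasFDerivAt.finsetProd (u := Finset.univ) fun k _ => (hfactor k).hasFDerivAt
  exact (hprod.differentiableAt.const_mul _).differentiableWithinAt

end HolomorphicWeights

section HankelContour

variable {ε u : ℝ}

theorem hankelRadius_eq (ε u : ℝ) :
    hankelRadius ε u = ε + max 0 (-u) + max 0 (u - 2 * Real.pi) := by
  have hπ := Real.pi_pos
  unfold hankelRadius
  split_ifs
  · rw [max_eq_right (by linarith), max_eq_left (by linarith)]; ring
  · rw [max_eq_left (by linarith), max_eq_left (by linarith)]; ring
  · rw [max_eq_left (by linarith), max_eq_right (by linarith)]; ring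

theorem hankelArg_eq (u : ℝ) : hankelArg u = min (max u 0) (2 * Real.pi) := by
  have hπ := Real.pi_pos
  unfold hankelArg
  split_ifs
  · rw [max_eq_right (by linarith), min_eq_left (by linarith)]
  · rw [max_eq_left (by linarith), min_eq_left (by linarith)]
  · rw [max_eq_left (by linarith), min_eq_right (by linarith)]

theorem continuous_hankelRadius (ε : ℝ) : Continuous (hankelRadius ε) := by
  simp only [funext (hankelRadius_eq ε)]
  fun_prop

theorem continuous_hankelArg : Continuous hankelArg := by
  simp only [funext hankelArg_eq]
  fun_prop

theorem le_hankelRadius (ε u : ℝ) : ε ≤ hankelRadius ε u := by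
  rw [hankelRadius_eq]
  linarith [le_max_left 0 (-u), le_max_left 0 (u - 2 * Real.pi)]

theorem abs_sub_two_pi_le_hankelRadius (hε : 0 ≤ ε) (u : ℝ) :
    |u| - 2 * Real.pi ≤ hankelRadius ε u := by
  rw [hankelRadius_eq]
  rcases abs_cases u with h | h <;> rw [h.1] <;>
  linarith [le_max_left 0 (-u), le_max_left 0 (u - 2 * Real.pi), le_max_right 0 (-u),
    le_max_right 0 (u - 2 * Real.pi), Real.pi_pos]

theorem abs_hankelArg_le (u : ℝ) : |hankelArg u| ≤ 2 * Real.pi := by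
  rw [hankelArg_eq, abs_of_nonneg (le_min (le_max_right _ _) (by positivity))]
  exact min_le_right _ _

theorem continuous_hankelPath (ε : ℝ) : Continuous (hankelPath ε) := by
  have hradius := continuous_hankelRadius ε
  have harg := continuous_hankelArg
  unfold hankelPath
  fun_prop

theorem hankelPath_of_neg (hu : u < 0) : hankelPath ε u = ((ε - u : ℝ) : ℂ) := by
  simp [hankelPath, hankelRadius, hankelArg, hu]

theorem hankelPath_of_mem_Icc (h₀ : 0 ≤ u) (h₁ : u ≤ 2 * Real.pi) :
    hankelPath ε u = (ε : ℂ) * Complex.exp (Complex.I * (u : ℂ)) := by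
  simp [hankelPath, hankelRadius, hankelArg, not_lt.2 h₀, h₁]

theorem hankelPath_of_gt (hu : 2 * Real.pi < u) :
    hankelPath ε u = ((ε + (u - 2 * Real.pi) : ℝ) : ℂ) := by
  have h₀ : ¬ u < 0 := by linarith [Real.pi_pos]
  simp [hankelPath, hankelRadius, hankelArg, h₀, not_le.2 hu, mul_comm Complex.I,
    Complex.exp_two_pi_mul_I]

theorem hankelRadius_sub_le_re_hankelPath (hε : 0 ≤ ε) (u : ℝ) :
    hankelRadius ε u - 2 * ε ≤ (hankelPath ε u).re := by
  rcases lt_or_ge u 0 with h₀ | h₀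
  · rw [hankelPath_of_neg h₀, Complex.ofReal_re, hankelRadius, if_pos h₀]
    linarith
  rcases le_or_gt u (2 * Real.pi) with h₁ | h₁
  · rw [hankelPath_of_mem_Icc h₀ h₁, hankelRadius, if_neg (not_lt.2 h₀), if_pos h₁,
      Complex.re_ofReal_mul, mul_comm Complex.I, Complex.exp_ofReal_mul_I_re]
    nlinarith [Real.neg_one_le_cos u]
  · rw [hankelPath_of_gt h₁, Complex.ofReal_re, hankelRadius, if_neg (not_lt.2 h₀),
      if_neg (not_le.2 h₁)]
    linarith

theorem isNearRay_hankelPath (hε : 0 ≤ ε) : IsNearRay ε (hankelPath ε) where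
  continuous := continuous_hankelPath ε
  neg_le_re u := by linarith [hankelRadius_sub_le_re_hankelPath hε u, le_hankelRadius ε u]
  abs_im_le u := by
    rcases lt_or_ge u 0 with h₀ | h₀
    · rwa [hankelPath_of_neg h₀, Complex.ofReal_im, abs_zero]
    rcases le_or_gt u (2 * Real.pi) with h₁ | h₁
    · rw [hankelPath_of_mem_Icc h₀ h₁, Complex.im_ofReal_mul, mul_comm Complex.I,
        Complex.exp_ofReal_mul_I_im, abs_mul, abs_of_nonneg hε]
      exact mul_le_of_le_one_right hε (Real.abs_sin_le_one u)
    · rwa [hankelPath_of_gt h₁, Complex.ofReal_im, abs_zero]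

theorem norm_hankelVel_le (hε : 0 ≤ ε) (u : ℝ) : ‖hankelVel ε u‖ ≤ 1 + ε := by
  unfold hankelVel
  split_ifs
  · simpa using hε
  · rw [norm_mul, norm_mul, mul_comm Complex.I, Complex.norm_exp_ofReal_mul_I]
    simp [abs_of_nonneg hε]
  · simpa using hε

theorem measurable_hankelVel (ε : ℝ) : Measurable (hankelVel ε) := by
  unfold hankelVel
  exact Measurable.ite measurableSet_Iio measurable_const
    (Measurable.ite measurableSet_Iic (by fun_prop) measurable_const)

theorem measurable_hankelPow (ε : ℝ) (z : ℂ) : Measurable (hankelPow ε z) := by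
  have hradius := (continuous_hankelRadius ε).measurable
  have harg := continuous_hankelArg.measurable
  unfold hankelPow
  fun_prop

theorem norm_hankelPow_le (ε : ℝ) (z : ℂ) (u : ℝ) :
    ‖hankelPow ε z u‖ ≤ Real.exp (‖z‖ * (|Real.log (hankelRadius ε u)| + 2 * Real.pi)) := by
  refine (Complex.norm_exp_le_exp_norm _).trans (Real.exp_le_exp.2 ?_)
  rw [norm_mul]
  gcongr
  refine (norm_add_le _ _).trans (add_le_add ?_ ?_)
  · rw [Complex.norm_real, Real.norm_eq_abs]
  · simpa using abs_hankelArg_le u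

theorem abs_log_le_mul_add {R η : ℝ} (hε : 0 < ε) (hη : 0 < η) (hR : ε ≤ R) :
    |Real.log R| ≤ η * R + (|Real.log η| + |Real.log ε|) := by
  have hR₀ : 0 < R := hε.trans_le hR
  have hηR : 0 < η * R := by positivity
  have hupper : Real.log R ≤ η * R - Real.log η := by
    have := Real.log_le_sub_one_of_pos hηR
    rw [Real.log_mul hη.ne' hR₀.ne'] at this
    linarith
  have hlower := Real.log_le_log hε hR
  rw [abs_le]
  constructor
  · linarith [neg_abs_le (Real.log ε), abs_nonneg (Real.log η)]
  · linarith [neg_abs_le (Real.log η), abs_nonneg (Real.log ε)]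

/-- The differential `x ^ (s - 1) dx` on the Hankel contour, in the parameter of the contour. -/
noncomputable def hankelWeight (ε : ℝ) (s : ℂ) (u : ℝ) : ℂ :=
  hankelPow ε (s - 1) u * hankelVel ε u

theorem exists_norm_hankelWeight_mul_le (hε : 0 < ε) {β B : ℝ} (hβ : 0 < β) (hB : 0 < B) :
    ∃ C, ∀ s : ℂ, ‖s - 1‖ ≤ B → ∀ u,
      ‖hankelWeight ε s u‖ * Real.exp (-(β * (hankelPath ε u).re)) ≤
        C * Real.exp (-(β / 2) * |u|) := by
  set η := β / (2 * B)
  set c := |Real.log η| + |Real.log ε|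
  refine ⟨Real.exp (B * (c + 2 * Real.pi) + 2 * β * ε + β * Real.pi) * (1 + ε), fun s hs u => ?_⟩
  set R := hankelRadius ε u
  have hlog : |Real.log R| ≤ η * R + c :=
    abs_log_le_mul_add hε (by positivity) (le_hankelRadius ε u)
  have hηB : B * (η * R) = β / 2 * R := by simp only [η]; field_simp
  have hpow : ‖hankelPow ε (s - 1) u‖ ≤
      Real.exp (β / 2 * R + B * (c + 2 * Real.pi)) := by
    refine (norm_hankelPow_le ε _ u).trans (Real.exp_le_exp.2 ?_)
    calc ‖s - 1‖ * (|Real.log R| + 2 * Real.pi) ≤ B * (η * R + c + 2 * Real.pi) := by gcongr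
      _ = _ := by rw [← hηB]; ring
  have hpath : Real.exp (-(β * (hankelPath ε u).re)) ≤ Real.exp (-(β * (R - 2 * ε))) := by
    gcongr
    exact hankelRadius_sub_le_re_hankelPath hε.le u
  have hu : β / 2 * |u| ≤ β / 2 * R + β * Real.pi := by
    nlinarith [abs_sub_two_pi_le_hankelRadius hε.le u]
  calc ‖hankelWeight ε s u‖ * Real.exp (-(β * (hankelPath ε u).re))
      ≤ Real.exp (β / 2 * R + B * (c + 2 * Real.pi)) * (1 + ε) *
          Real.exp (-(β * (R - 2 * ε))) := by
        rw [hankelWeight, norm_mul]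
        gcongr
        exact norm_hankelVel_le hε.le u
    _ = Real.exp (β / 2 * R + B * (c + 2 * Real.pi) + -(β * (R - 2 * ε))) * (1 + ε) := by
        rw [Real.exp_add _ (-(β * (R - 2 * ε)))]
        ring
    _ ≤ Real.exp (B * (c + 2 * Real.pi) + 2 * β * ε + β * Real.pi + -(β / 2) * |u|) *
          (1 + ε) := by
        refine mul_le_mul_of_nonneg_right (Real.exp_le_exp.2 ?_) (by positivity)
        linarith
    _ = _ := by
        rw [Real.exp_add _ (-(β / 2) * |u|)]
        ring

theorem isHolomorphicWeightAt_hankelWeight (hε : 0 < ε) (s₀ : ℂ) :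
    IsHolomorphicWeightAt ε (hankelPath ε) (hankelWeight ε) s₀ where
  toIsNearRay := isNearRay_hankelPath hε.le
  eventually_measurable := Eventually.of_forall fun _ =>
    (measurable_hankelPow ε _).mul (measurable_hankelVel ε)
  eventually_differentiableAt := Eventually.of_forall fun _ _ => by
    unfold hankelWeight hankelPow
    fun_prop
  exists_eventually_le β hβ := by
    obtain ⟨C, hC⟩ := exists_norm_hankelWeight_mul_le hε hβ (B := ‖s₀ - 1‖ + 1) (by positivity)
    have hnear : ∀ᶠ s : ℂ in 𝓝 s₀, ‖s - 1‖ < ‖s₀ - 1‖ + 1 :=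
      (by fun_prop : ContinuousAt (fun s : ℂ => ‖s - 1‖) s₀).eventually_lt_const (lt_add_one _)
    exact ⟨C, β / 2, half_pos hβ, hnear.mono fun s hs => hC s hs.le⟩

/-- The factor `Γ(1-s) e^{-πis} / (2πi)`, which is `1 / ((e^{2πis} - 1) Γ(s))` for `s ∉ ℤ` and has
no poles in `Re s < 1`. -/
noncomputable def hankelFactor (s : ℂ) : ℂ :=
  Complex.Gamma (1 - s) * Complex.exp (-(Real.pi * Complex.I * s)) / (2 * Real.pi * Complex.I)

/-- The weight of the normalized transform `f ↦ Γ(1-s) e^{-πis} / (2πi) ∫_C f(w+x) x^{s-1} dx`. -/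
noncomputable def hankelDensity (ε : ℝ) (s : ℂ) (u : ℝ) : ℂ :=
  hankelFactor s * hankelWeight ε s u

theorem differentiableAt_hankelFactor {s : ℂ} (hs : s.re < 1) :
    DifferentiableAt ℂ hankelFactor s := by
  have hΓ : DifferentiableAt ℂ (fun s : ℂ => Complex.Gamma (1 - s)) s := by
    refine (Complex.differentiableAt_Gamma _ fun m h => ?_).comp s (by fun_prop)
    have hre := congrArg Complex.re h
    simp only [Complex.sub_re, Complex.one_re, Complex.neg_re, Complex.natCast_re] at hre
    linarith [(Nat.cast_nonneg m : (0 : ℝ) ≤ m)]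
  exact (hΓ.mul (by fun_prop)).div_const _

theorem isHolomorphicWeightAt_hankelDensity (hε : 0 < ε) {s₀ : ℂ} (hs₀ : s₀.re < 1) :
    IsHolomorphicWeightAt ε (hankelPath ε) (hankelDensity ε) s₀ :=
  (isHolomorphicWeightAt_hankelWeight hε s₀).const_mul <|
    (Complex.continuous_re.continuousAt.eventually_lt_const hs₀).mono fun _ =>
      differentiableAt_hankelFactor

theorem isWeightedPath_hankelDensity (hε : 0 < ε) (s : ℂ) :
    IsWeightedPath ε (hankelPath ε) (hankelDensity ε s) :=
  ((isHolomorphicWeightAt_hankelWeight hε s).const_mul (c := fun _ => hankelFactor s)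
    (Eventually.of_forall fun _ => differentiableAt_const _)).isWeightedPath

end HankelContour

section PositiveRay

/-- The positive real axis, parametrized by the logarithm. -/
noncomputable def rayPath (u : ℝ) : ℂ := Complex.exp u

/-- The weight of the normalized Mellin transform `f ↦ Γ(s)⁻¹ ∫_0^∞ f(w+x) x^{s-1} dx` in the
logarithmic parameter. -/
noncomputable def rayDensity (s : ℂ) (u : ℝ) : ℂ := (Complex.Gamma s)⁻¹ * Complex.exp (s * u)

theorem rayPath_eq_ofReal (u : ℝ) : rayPath u = (Real.exp u : ℝ) := by simp [rayPath]

theorem isNearRay_rayPath {ε : ℝ} (hε : 0 ≤ ε) : IsNearRay ε rayPath where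
  continuous := by unfold rayPath; fun_prop
  neg_le_re u := by
    rw [rayPath_eq_ofReal, Complex.ofReal_re]
    linarith [Real.exp_pos u]
  abs_im_le u := by rwa [rayPath_eq_ofReal, Complex.ofReal_im, abs_zero]

theorem exists_norm_exp_mul_le {a B β : ℝ} (ha : 0 < a) (hB : 0 < B) (hβ : 0 < β) :
    ∃ C, ∀ s : ℂ, a ≤ s.re → s.re ≤ B → ∀ u : ℝ,
      ‖Complex.exp (s * u)‖ * Real.exp (-(β * (rayPath u).re)) ≤ C * Real.exp (-a * |u|) := by
  set c := |Real.log (β / (B + a))|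
  refine ⟨Real.exp ((B + a) * c), fun s has hsB u => ?_⟩
  rw [Complex.norm_exp, Complex.re_mul_ofReal, rayPath_eq_ofReal, Complex.ofReal_re,
    ← Real.exp_add, ← Real.exp_add]
  refine Real.exp_le_exp.2 ?_
  rcases le_total u 0 with hu | hu
  · rw [abs_of_nonpos hu]
    have hβu : 0 < β * Real.exp u := by positivity
    have hc : 0 ≤ (B + a) * c := by positivity
    linarith [mul_le_mul_of_nonpos_right has hu]
  · have hlog := abs_log_le_mul_add one_pos (show 0 < β / (B + a) by positivity)
      (Real.one_le_exp hu)
    rw [Real.log_exp, abs_of_nonneg hu, Real.log_one, abs_zero, add_zero] at hlog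
    have hmul := mul_le_mul_of_nonneg_left hlog (by positivity : 0 ≤ B + a)
    rw [mul_add, ← mul_assoc, mul_div_cancel₀ _ (by positivity)] at hmul
    rw [abs_of_nonneg hu]
    linarith [mul_le_mul_of_nonneg_right hsB hu]

theorem isHolomorphicWeightAt_exp_mul {ε : ℝ} (hε : 0 ≤ ε) {s₀ : ℂ} (hs₀ : 0 < s₀.re) :
    IsHolomorphicWeightAt ε rayPath (fun s u => Complex.exp (s * u)) s₀ where
  toIsNearRay := isNearRay_rayPath hε
  eventually_measurable := Eventually.of_forall fun _ => by fun_prop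
  eventually_differentiableAt := Eventually.of_forall fun _ _ => by fun_prop
  exists_eventually_le β hβ := by
    obtain ⟨C, hC⟩ := exists_norm_exp_mul_le (half_pos hs₀) (B := s₀.re + 1) (by positivity) hβ
    have hlower : ∀ᶠ s : ℂ in 𝓝 s₀, s₀.re / 2 < s.re :=
      Complex.continuous_re.continuousAt.eventually_const_lt (half_lt_self hs₀)
    have hupper : ∀ᶠ s : ℂ in 𝓝 s₀, s.re < s₀.re + 1 :=
      Complex.continuous_re.continuousAt.eventually_lt_const (lt_add_one _)
    refine ⟨C, s₀.re / 2, half_pos hs₀, ?_⟩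
    filter_upwards [hlower, hupper] with s hl hu using hC s hl.le hu.le

theorem isHolomorphicWeightAt_rayDensity {ε : ℝ} (hε : 0 ≤ ε) {s₀ : ℂ} (hs₀ : 0 < s₀.re) :
    IsHolomorphicWeightAt ε rayPath rayDensity s₀ :=
  (isHolomorphicWeightAt_exp_mul hε hs₀).const_mul <|
    Eventually.of_forall fun _ => Complex.differentiable_one_div_Gamma _

end PositiveRay

section LogarithmicParameter

/-- The integrand of `∫ f(w+x) x^{s-1} dx` in the logarithmic parameter `x = e^z`. -/
noncomputable def logIntegrand (f : ℂ → ℂ) (w s z : ℂ) : ℂ :=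
  f (w + Complex.exp z) * Complex.exp (s * z)

theorem logIntegrand_add_two_pi_mul_I (f : ℂ → ℂ) (w s z : ℂ) :
    logIntegrand f w s (z + 2 * Real.pi * Complex.I) =
      Complex.exp (2 * Real.pi * Complex.I * s) * logIntegrand f w s z := by
  rw [logIntegrand, logIntegrand, Complex.exp_add z, Complex.exp_two_pi_mul_I, mul_add,
    Complex.exp_add (s * z), mul_one, mul_comm s (2 * Real.pi * Complex.I)]
  ring

theorem pathTransform_rayDensity (f : ℂ → ℂ) (w s : ℂ) :
    pathTransform rayPath (rayDensity s) f w =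
      (Complex.Gamma s)⁻¹ * ∫ v : ℝ, logIntegrand f w s v := by
  rw [pathTransform, ← integral_const_mul]
  refine integral_congr_ae (ae_of_all _ fun v => ?_)
  simp only [rayPath, rayDensity, logIntegrand]
  ring

variable {δ ε : ℝ} {f : ℂ → ℂ} {w s : ℂ}

theorem add_exp_mem_halfStrip (hε : 0 < ε) (hw : w ∈ halfStrip (δ - ε)) {z : ℂ}
    (hz : z.re ≤ Real.log ε) : w + Complex.exp z ∈ halfStrip δ := by
  have hnorm : ‖Complex.exp z‖ ≤ ε := by
    rwa [Complex.norm_exp, ← Real.le_log_iff_exp_le hε]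
  exact add_mem_halfStrip hw (abs_le.1 ((Complex.abs_re_le_norm _).trans hnorm)).1
    ((Complex.abs_im_le_norm _).trans hnorm)

theorem IsDecaying.differentiableAt_logIntegrand (hf : IsDecaying δ f) {z : ℂ}
    (hz : w + Complex.exp z ∈ halfStrip δ) : DifferentiableAt ℂ (logIntegrand f w s) z := by
  have hcomp : DifferentiableAt ℂ (fun z => f (w + Complex.exp z)) z :=
    DifferentiableAt.comp z (hf.differentiableAt hz) (by fun_prop)
  exact hcomp.mul (by fun_prop)

theorem IsDecaying.integrable_logIntegrand (hf : IsDecaying δ f) (hw : w ∈ halfStrip δ)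
    (hs : 0 < s.re) : Integrable fun v : ℝ => logIntegrand f w s v :=
  hf.integrable_comp_add_mul (isHolomorphicWeightAt_exp_mul le_rfl hs).isWeightedPath
    (by rwa [sub_zero])

theorem IsDecaying.integrableOn_logIntegrand_Ioi (hf : IsDecaying δ f) (hw : w ∈ halfStrip δ)
    (s : ℂ) (c : ℝ) : IntegrableOn (fun v : ℝ => logIntegrand f w s v) (Set.Ioi c) := by
  set N : ℝ := |s.re| + 1
  have hpos : 0 < (s + N).re := by
    rw [Complex.add_re, Complex.ofReal_re]
    linarith [neg_abs_le s.re]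
  have hbound : ∀ᵐ v : ℝ ∂volume.restrict (Set.Ioi c),
      ‖Complex.exp (-(N * v : ℝ))‖ ≤ Real.exp (-(N * c)) := by
    filter_upwards [ae_restrict_mem measurableSet_Ioi] with v hv
    rw [← Complex.ofReal_neg, Complex.norm_exp_ofReal]
    have : c ≤ v := le_of_lt hv
    gcongr
  refine ((hf.integrable_logIntegrand hw hpos).integrableOn.bdd_mul (by fun_prop) hbound).congr
    (ae_of_all _ fun v => ?_)
  simp only [logIntegrand]
  rw [mul_left_comm, ← Complex.exp_add]
  congr 2
  push_cast
  ring

/-- Cauchy's theorem for the rectangle with corners `a` and `b + 2πi`, whose horizontal sides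
differ by the monodromy `e^{2πis}` of `x^s`. -/
theorem IsDecaying.circle_sub_circle_logIntegrand (hε : 0 < ε) (hf : IsDecaying δ f)
    (hw : w ∈ halfStrip (δ - ε)) (s : ℂ) {a b : ℝ} (ha : a ≤ Real.log ε) (hb : b ≤ Real.log ε) :
    Complex.I * (∫ θ in (0 : ℝ)..2 * Real.pi, logIntegrand f w s (b + θ * Complex.I)) -
      Complex.I * (∫ θ in (0 : ℝ)..2 * Real.pi, logIntegrand f w s (a + θ * Complex.I)) =
    (Complex.exp (2 * Real.pi * Complex.I * s) - 1) *
      ∫ v in a..b, logIntegrand f w s (v : ℝ) := by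
  have hdiff : DifferentiableOn ℂ (logIntegrand f w s) {z | z.re ≤ Real.log ε} := fun z hz =>
    (hf.differentiableAt_logIntegrand (add_exp_mem_halfStrip hε hw hz)).differentiableWithinAt
  have hperiod : ∀ z : ℂ, logIntegrand f w s (z + (2 * Real.pi : ℝ) * Complex.I) =
      Complex.exp (2 * Real.pi * Complex.I * s) * logIntegrand f w s z := fun z => by
    rw [← logIntegrand_add_two_pi_mul_I]
    push_cast
    rfl
  have hrect := Complex.integral_boundary_rect_eq_zero_of_differentiableOn (logIntegrand f w s)
    (a : ℂ) (b + (2 * Real.pi : ℝ) * Complex.I) <| hdiff.mono fun z hz =>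
      hz.1.2.trans (max_le (by simpa using ha) (by simpa using hb))
  simp only [Complex.ofReal_re, Complex.ofReal_im, Complex.add_re, Complex.add_im, Complex.mul_re,
    Complex.mul_im, Complex.I_re, Complex.I_im, mul_zero, mul_one, zero_mul, sub_zero, add_zero,
    zero_add, Complex.ofReal_zero, smul_eq_mul, hperiod,
    intervalIntegral.integral_const_mul] at hrect
  linear_combination hrect

theorem IsDecaying.tendsto_circle_logIntegrand_atBot (hε : 0 < ε) (hf : IsDecaying δ f)
    (hw : w ∈ halfStrip (δ - ε)) (hs : 0 < s.re) :
    Tendsto (fun a : ℝ => ∫ θ in (0 : ℝ)..2 * Real.pi, logIntegrand f w s (a + θ * Complex.I))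
      atBot (𝓝 0) := by
  obtain ⟨B, hB⟩ := hf.exists_norm_le
  have hlim : Tendsto (fun a : ℝ => B * (Real.exp (s.re * a) * Real.exp (|s.im| * (2 * Real.pi))) *
      |2 * Real.pi - 0|) atBot (𝓝 0) := by
    have hexp : Tendsto (fun a : ℝ => Real.exp (s.re * a)) atBot (𝓝 0) :=
      Real.tendsto_exp_atBot.comp (tendsto_id.const_mul_atBot hs)
    simpa using ((hexp.mul_const (Real.exp (|s.im| * (2 * Real.pi)))).const_mul B).mul_const
      |2 * Real.pi - 0|
  refine squeeze_zero_norm' ?_ hlim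
  filter_upwards [eventually_le_atBot (Real.log ε)] with a ha
  refine intervalIntegral.norm_integral_le_of_norm_le_const fun θ hθ => ?_
  rw [Set.uIoc_of_le (by positivity)] at hθ
  have hf_le : ‖f (w + Complex.exp (a + θ * Complex.I))‖ ≤ B := by
    refine hB _ (halfStrip_mono le_rfl (add_exp_mem_halfStrip hε hw ?_))
    simpa using ha
  have him : -(s.im * θ) ≤ |s.im| * (2 * Real.pi) := by
    refine (neg_le_abs _).trans ?_
    rw [abs_mul, abs_of_pos hθ.1]
    exact mul_le_mul_of_nonneg_left hθ.2 (abs_nonneg _)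
  have hexp_le : ‖Complex.exp (s * (a + θ * Complex.I))‖ ≤
      Real.exp (s.re * a) * Real.exp (|s.im| * (2 * Real.pi)) := by
    have hre : (s * (a + θ * Complex.I)).re = s.re * a - s.im * θ := by simp
    rw [Complex.norm_exp, ← Real.exp_add, hre]
    exact Real.exp_le_exp.2 (by linarith)
  rw [logIntegrand, norm_mul]
  exact mul_le_mul hf_le hexp_le (norm_nonneg _) ((norm_nonneg _).trans hf_le)

end LogarithmicParameter

section HankelTransform

variable {δ ε : ℝ} {f : ℂ → ℂ} {w s : ℂ}

theorem setIntegral_hankelPath_Iio (hε : 0 < ε) (f : ℂ → ℂ) (w s : ℂ) :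
    ∫ u in Set.Iio 0, f (w + hankelPath ε u) * hankelWeight ε s u =
      -∫ v in Set.Ioi (Real.log ε), logIntegrand f w s (v : ℝ) := by
  have himage : (fun v : ℝ => ε - Real.exp v) '' Set.Ioi (Real.log ε) = Set.Iio 0 := by
    have hcomp : (fun v : ℝ => ε - Real.exp v) = (fun x => ε - x) ∘ Real.exp := rfl
    rw [hcomp, Set.image_comp, Real.image_exp_Ioi, Real.exp_log hε, Set.image_const_sub_Ioi,
      sub_self]
  rw [← himage, integral_image_eq_integral_abs_deriv_smul measurableSet_Ioi
    (fun v _ => ((Real.hasDerivAt_exp v).const_sub ε).hasDerivWithinAt)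
    (fun a _ b _ h => Real.exp_injective (by simpa using h)), ← integral_neg]
  refine setIntegral_congr_fun measurableSet_Ioi fun v hv => ?_
  have hneg : ε - Real.exp v < 0 := sub_neg.2 ((Real.log_lt_iff_lt_exp hε).1 hv)
  have hexp : Complex.exp (s * v) = Complex.exp v * Complex.exp ((s - 1) * v) := by
    rw [← Complex.exp_add]
    ring_nf
  simp only [hankelPath_of_neg hneg, hankelWeight, hankelPow, hankelRadius, hankelArg, hankelVel,
    if_pos hneg, sub_sub_cancel, Real.log_exp, abs_neg, abs_of_pos (Real.exp_pos v), logIntegrand,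
    Complex.real_smul, Complex.ofReal_exp, Complex.ofReal_zero, mul_zero, add_zero, hexp]
  ring

theorem setIntegral_hankelPath_Ioi (hε : 0 < ε) (f : ℂ → ℂ) (w s : ℂ) :
    ∫ u in Set.Ioi (2 * Real.pi), f (w + hankelPath ε u) * hankelWeight ε s u =
      Complex.exp (2 * Real.pi * Complex.I * s) *
        ∫ v in Set.Ioi (Real.log ε), logIntegrand f w s (v : ℝ) := by
  have himage : (fun v : ℝ => Real.exp v + (2 * Real.pi - ε)) '' Set.Ioi (Real.log ε) =
      Set.Ioi (2 * Real.pi) := by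
    have hcomp : (fun v : ℝ => Real.exp v + (2 * Real.pi - ε)) =
        (fun x => x + (2 * Real.pi - ε)) ∘ Real.exp := rfl
    rw [hcomp, Set.image_comp, Real.image_exp_Ioi, Real.exp_log hε, Set.image_add_const_Ioi,
      add_sub_cancel]
  rw [← himage, integral_image_eq_integral_abs_deriv_smul measurableSet_Ioi
    (fun v _ => ((Real.hasDerivAt_exp v).add_const _).hasDerivWithinAt)
    (fun a _ b _ h => Real.exp_injective (by simpa using h)), ← integral_const_mul]
  refine setIntegral_congr_fun measurableSet_Ioi fun v hv => ?_
  have hgt : 2 * Real.pi < Real.exp v + (2 * Real.pi - ε) := by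
    linarith [(Real.log_lt_iff_lt_exp hε).1 hv]
  have hnonneg : ¬ Real.exp v + (2 * Real.pi - ε) < 0 := by linarith [Real.pi_pos]
  have hradius : ε + (Real.exp v + (2 * Real.pi - ε) - 2 * Real.pi) = Real.exp v := by ring
  have hexp : Complex.exp v * Complex.exp ((s - 1) * (v + Complex.I * ((2 * Real.pi : ℝ) : ℂ))) =
      Complex.exp (2 * Real.pi * Complex.I * s) * Complex.exp (s * v) := by
    rw [← Complex.exp_add, ← Complex.exp_add, ← Complex.exp_periodic]
    push_cast
    ring_nf
  simp only [hankelPath_of_gt hgt, hankelWeight, hankelPow, hankelRadius, hankelArg, hankelVel,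
    if_neg hnonneg, if_neg (not_le.2 hgt), hradius, Real.log_exp, abs_of_pos (Real.exp_pos v),
    logIntegrand, Complex.real_smul, Complex.ofReal_exp, mul_one]
  rw [mul_left_comm, hexp]
  ring

theorem setIntegral_hankelPath_Icc (hε : 0 < ε) (f : ℂ → ℂ) (w s : ℂ) :
    ∫ u in Set.Icc 0 (2 * Real.pi), f (w + hankelPath ε u) * hankelWeight ε s u =
      Complex.I * ∫ θ in (0 : ℝ)..2 * Real.pi,
        logIntegrand f w s (Real.log ε + θ * Complex.I) := by
  rw [integral_Icc_eq_integral_Ioc, intervalIntegral.integral_of_le (by positivity),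
    ← integral_const_mul]
  refine setIntegral_congr_fun measurableSet_Ioc fun u hu => ?_
  have hpoint : Complex.exp (Real.log ε + u * Complex.I) = ε * Complex.exp (Complex.I * u) := by
    rw [Complex.exp_add, ← Complex.ofReal_exp, Real.exp_log hε, mul_comm Complex.I]
  have hexp : Complex.exp (s * (Real.log ε + u * Complex.I)) =
      Complex.exp ((s - 1) * (Real.log ε + Complex.I * u)) * (ε * Complex.exp (Complex.I * u)) := by
    rw [← hpoint, ← Complex.exp_add]
    ring_nf
  simp only [hankelPath_of_mem_Icc hu.1.le hu.2, hankelWeight, hankelPow, hankelRadius, hankelArg,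
    hankelVel, if_neg (not_lt.2 hu.1.le), if_pos hu.2, logIntegrand, hpoint, hexp]
  ring

theorem IsDecaying.pathTransform_hankelDensity (hε : 0 < ε) (hf : IsDecaying δ f)
    (hw : w ∈ halfStrip (δ - ε)) (s : ℂ) :
    _root_.pathTransform (hankelPath ε) (hankelDensity ε s) f w = hankelFactor s *
      ((Complex.exp (2 * Real.pi * Complex.I * s) - 1) *
          (∫ v in Set.Ioi (Real.log ε), logIntegrand f w s (v : ℝ)) +
        Complex.I * ∫ θ in (0 : ℝ)..2 * Real.pi,
          logIntegrand f w s (Real.log ε + θ * Complex.I)) := by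
  have hint := hf.integrable_comp_add_mul
    (isHolomorphicWeightAt_hankelWeight hε s).isWeightedPath hw
  have hfactor : _root_.pathTransform (hankelPath ε) (hankelDensity ε s) f w =
      hankelFactor s * ∫ u, f (w + hankelPath ε u) * hankelWeight ε s u := by
    simp only [_root_.pathTransform, hankelDensity, mul_left_comm _ (hankelFactor s),
      integral_const_mul]
  have hIio := intervalIntegral.integral_Iio_add_Ici
    (hint.integrableOn (s := Set.Iio 0)) hint.integrableOn
  have hIci : ∫ u in Set.Ici 0, f (w + hankelPath ε u) * hankelWeight ε s u =
      (∫ u in Set.Icc 0 (2 * Real.pi), f (w + hankelPath ε u) * hankelWeight ε s u) +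
        ∫ u in Set.Ioi (2 * Real.pi), f (w + hankelPath ε u) * hankelWeight ε s u := by
    rw [← Set.Icc_union_Ioi_eq_Ici (by positivity : 0 ≤ 2 * Real.pi)]
    exact setIntegral_union (Set.disjoint_left.2 fun u hu hu' => absurd hu.2 (not_le.2 hu'))
      measurableSet_Ioi hint.integrableOn hint.integrableOn
  rw [hfactor, ← hIio, hIci, setIntegral_hankelPath_Iio hε, setIntegral_hankelPath_Icc hε,
    setIntegral_hankelPath_Ioi hε]
  ring

theorem IsDecaying.pathTransform_hankelDensity_eq_of_le {ε' : ℝ} (hε' : 0 < ε') (hle : ε' ≤ ε)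
    (hf : IsDecaying δ f) (hw : w ∈ halfStrip (δ - ε)) (s : ℂ) :
    _root_.pathTransform (hankelPath ε) (hankelDensity ε s) f w =
      _root_.pathTransform (hankelPath ε') (hankelDensity ε' s) f w := by
  have hε : 0 < ε := hε'.trans_le hle
  have hwδ : w ∈ halfStrip δ := halfStrip_mono (by linarith) hw
  rw [hf.pathTransform_hankelDensity hε hw,
    hf.pathTransform_hankelDensity hε' (halfStrip_mono (by linarith) hw),
    ← intervalIntegral.integral_interval_add_Ioi
      (hf.integrableOn_logIntegrand_Ioi hwδ s (Real.log ε'))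
      (hf.integrableOn_logIntegrand_Ioi hwδ s (Real.log ε))]
  linear_combination hankelFactor s * hf.circle_sub_circle_logIntegrand hε hw s
    (Real.log_le_log hε' hle) le_rfl

theorem exp_two_pi_mul_I_mul_sub_one_ne_zero (hs : ∀ n : ℤ, s ≠ n) :
    Complex.exp (2 * Real.pi * Complex.I * s) - 1 ≠ 0 := by
  intro h
  obtain ⟨n, hn⟩ := Complex.exp_eq_one_iff.1 (sub_eq_zero.1 h)
  rw [mul_comm] at hn
  exact hs n (mul_right_cancel₀ Complex.two_pi_I_ne_zero hn)

theorem exp_div_mul_exp_sub_one_eq_sin_div (s : ℂ) :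
    Complex.exp (-(Real.pi * Complex.I * s)) / (2 * Real.pi * Complex.I) *
      (Complex.exp (2 * Real.pi * Complex.I * s) - 1) = Complex.sin (Real.pi * s) / Real.pi := by
  have hsquare : Complex.exp (-(Real.pi * Complex.I * s)) *
      Complex.exp (2 * Real.pi * Complex.I * s) = Complex.exp (Real.pi * s * Complex.I) := by
    rw [← Complex.exp_add]
    ring_nf
  have hneg : -(Real.pi * s) * Complex.I = -(Real.pi * Complex.I * s) := by ring
  have hπ : (Real.pi : ℂ) ≠ 0 := Complex.ofReal_ne_zero.2 Real.pi_ne_zero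
  rw [Complex.sin, hneg, ← hsquare]
  field_simp
  rw [Complex.I_sq]
  ring

theorem hankelFactor_mul_exp_sub_one (hs : ∀ n : ℤ, s ≠ n) :
    hankelFactor s * (Complex.exp (2 * Real.pi * Complex.I * s) - 1) = (Complex.Gamma s)⁻¹ := by
  have hπ : (Real.pi : ℂ) ≠ 0 := Complex.ofReal_ne_zero.2 Real.pi_ne_zero
  have hsin : Complex.sin (Real.pi * s) ≠ 0 := by
    rw [Complex.sin_ne_zero_iff]
    intro n hn
    rw [mul_comm] at hn
    exact hs n (mul_right_cancel₀ hπ hn)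
  refine eq_inv_of_mul_eq_one_right ?_
  calc Complex.Gamma s * (hankelFactor s * (Complex.exp (2 * Real.pi * Complex.I * s) - 1))
      = (Complex.Gamma s * Complex.Gamma (1 - s)) * (Complex.exp (-(Real.pi * Complex.I * s)) /
        (2 * Real.pi * Complex.I) * (Complex.exp (2 * Real.pi * Complex.I * s) - 1)) := by
        rw [hankelFactor]
        ring
    _ = 1 := by
        rw [exp_div_mul_exp_sub_one_eq_sin_div, Complex.Gamma_mul_Gamma_one_sub]
        field_simp

theorem hankelFactor_eq (hs : ∀ n : ℤ, s ≠ n) :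
    hankelFactor s =
      1 / ((Complex.exp (2 * Real.pi * Complex.I * s) - 1) * Complex.Gamma s) := by
  rw [one_div, mul_inv, ← hankelFactor_mul_exp_sub_one hs, mul_comm (hankelFactor s),
    inv_mul_cancel_left₀ (exp_two_pi_mul_I_mul_sub_one_ne_zero hs)]

/-- Letting the radius of the circle tend to `0`, the contour collapses onto the ray. -/
theorem IsDecaying.pathTransform_hankelDensity_eq_rayDensity (hε : 0 < ε) (hf : IsDecaying δ f)
    (hw : w ∈ halfStrip (δ - ε)) (hs : 0 < s.re) (hn : ∀ n : ℤ, s ≠ n) :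
    _root_.pathTransform (hankelPath ε) (hankelDensity ε s) f w =
      _root_.pathTransform rayPath (rayDensity s) f w := by
  have hint := hf.integrable_logIntegrand (halfStrip_mono (by linarith) hw) hs
  set A := fun a : ℝ => Complex.I *
    ∫ θ in (0 : ℝ)..2 * Real.pi, logIntegrand f w s (a + θ * Complex.I) with hA
  have hcircle : A (Real.log ε) = (Complex.exp (2 * Real.pi * Complex.I * s) - 1) *
      ∫ v in Set.Iic (Real.log ε), logIntegrand f w s (v : ℝ) := by
    have hsegment := (intervalIntegral_tendsto_integral_Iic (Real.log ε) hint.integrableOn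
      tendsto_id).const_mul (Complex.exp (2 * Real.pi * Complex.I * s) - 1)
    have hshrink : Tendsto (fun a => A (Real.log ε) - A a) atBot (𝓝 (A (Real.log ε))) := by
      simpa using ((hf.tendsto_circle_logIntegrand_atBot hε hw hs).const_mul
        Complex.I).const_sub (A (Real.log ε))
    refine tendsto_nhds_unique_of_eventuallyEq hshrink hsegment ?_
    filter_upwards [eventually_le_atBot (Real.log ε)] with a ha
    exact hf.circle_sub_circle_logIntegrand hε hw s ha le_rfl
  simp only [hA] at hcircle
  rw [hf.pathTransform_hankelDensity hε hw, hcircle, pathTransform_rayDensity,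
    ← hankelFactor_mul_exp_sub_one hn,
    ← intervalIntegral.integral_Iic_add_Ioi hint.integrableOn hint.integrableOn]
  ring

end HankelTransform

section GeneratingFunction

/-- The generating function `w / (e^w - 1)` of the Bernoulli numbers, with its removable singularity
at `0` filled in. -/
noncomputable def bernoulliGen (w : ℂ) : ℂ := (dslope Complex.exp 0 w)⁻¹

/-- The derivative of `w / (e^w - 1)`, holomorphic for `|Im w| < 2π`; away from `0` each factor of
`hatKernel r t` is the value of this function at `y_j - log t`. -/
noncomputable def desFun : ℂ → ℂ := deriv bernoulliGen

/-- The difference quotient `(B(w) - B(cw)) / (w - cw)` of `B(w) = w / (e^w - 1)`, with the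
singularity at `w = 0` removed; away from `0` each factor of `(1-c)^{-r} desKernel r c` is its value
at `y_j`. -/
noncomputable def desQuotient (c : ℝ) (w : ℂ) : ℂ :=
  dslope (fun z => bernoulliGen z - bernoulliGen (c * z)) 0 w / (1 - c)

variable {c l : ℝ} {w : ℂ}

theorem exp_sub_one_ne_zero (hw : w ≠ 0) (him : |w.im| < 2 * Real.pi) :
    Complex.exp w - 1 ≠ 0 := by
  intro h
  obtain ⟨n, hn⟩ := Complex.exp_eq_one_iff.1 (sub_eq_zero.1 h)
  have hn_im : w.im = n * (2 * Real.pi) := by rw [hn]; simp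
  rw [hn_im, abs_mul, abs_of_pos Real.two_pi_pos, mul_lt_iff_lt_one_left Real.two_pi_pos] at him
  have hn_zero : n = 0 := Int.abs_lt_one_iff.1 (by exact_mod_cast him)
  exact hw (by rw [hn, hn_zero, Int.cast_zero, zero_mul])

theorem isOpen_abs_im_lt (a : ℝ) : IsOpen {w : ℂ | |w.im| < a} :=
  isOpen_lt Complex.continuous_im.abs continuous_const

theorem abs_im_lt_of_mem_halfStrip (hw : w ∈ halfStrip 2) : |w.im| < 2 * Real.pi := by
  linarith [hw.2, Real.pi_gt_three]

theorem bernoulliGen_of_ne (hw : w ≠ 0) : bernoulliGen w = w / (Complex.exp w - 1) := by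
  rw [bernoulliGen, dslope_of_ne _ hw, slope_def_field, Complex.exp_zero, sub_zero, inv_div]

theorem differentiableOn_bernoulliGen :
    DifferentiableOn ℂ bernoulliGen {w : ℂ | |w.im| < 2 * Real.pi} := by
  have hdslope : DifferentiableOn ℂ (dslope Complex.exp 0) Set.univ :=
    (Complex.differentiableOn_dslope univ_mem).2 Complex.differentiable_exp.differentiableOn
  refine (hdslope.mono (Set.subset_univ _)).inv fun w hw => ?_
  rcases eq_or_ne w 0 with rfl | hw₀
  · simp [dslope_same]
  · rw [dslope_of_ne _ hw₀, slope_def_field, Complex.exp_zero, sub_zero]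
    exact div_ne_zero (exp_sub_one_ne_zero hw₀ hw) hw₀

theorem hasDerivAt_bernoulliGen (him : |w.im| < 2 * Real.pi) :
    HasDerivAt bernoulliGen (desFun w) w :=
  (differentiableOn_bernoulliGen.differentiableAt
    ((isOpen_abs_im_lt _).mem_nhds him)).hasDerivAt

theorem differentiableOn_desFun : DifferentiableOn ℂ desFun {w : ℂ | |w.im| < 2 * Real.pi} :=
  differentiableOn_bernoulliGen.deriv (isOpen_abs_im_lt _)

theorem desFun_of_ne (hw : w ≠ 0) (him : |w.im| < 2 * Real.pi) :
    desFun w = 1 / (Complex.exp w - 1) - w * Complex.exp w / (Complex.exp w - 1) ^ 2 := by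
  have hne := exp_sub_one_ne_zero hw him
  have hquot : HasDerivAt (fun w : ℂ => w / (Complex.exp w - 1))
      ((1 * (Complex.exp w - 1) - w * Complex.exp w) / (Complex.exp w - 1) ^ 2) w :=
    (hasDerivAt_id w).div ((Complex.hasDerivAt_exp w).sub_const 1) hne
  have heq : bernoulliGen =ᶠ[𝓝 w] fun w : ℂ => w / (Complex.exp w - 1) := by
    filter_upwards [isOpen_ne.mem_nhds hw] with z hz using bernoulliGen_of_ne hz
  rw [desFun, (hquot.congr_of_eventuallyEq heq).deriv]
  field_simp

theorem norm_desFun_le_of_one_le_re (hre : 1 ≤ w.re) (him : |w.im| ≤ 2) :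
    ‖desFun w‖ ≤ 10 * Real.exp (-(1 / 2 * w.re)) := by
  set x := w.re with hx
  have hw : w ≠ 0 := by
    rintro rfl
    exact absurd hre (by simp [hx])
  have hnorm : ‖Complex.exp w‖ = Real.exp x := Complex.norm_exp w
  have hlower : Real.exp x / 2 ≤ ‖Complex.exp w - 1‖ := by
    have htri := norm_sub_norm_le (Complex.exp w) 1
    rw [hnorm, norm_one] at htri
    linarith [Real.add_one_le_exp x]
  have hnorm_w : ‖w‖ ≤ x + 2 := by
    have habs := Complex.norm_le_abs_re_add_abs_im w
    rw [← hx, abs_of_nonneg (by linarith : 0 ≤ x)] at habs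
    linarith
  rw [desFun_of_ne hw (by linarith [Real.pi_gt_three])]
  calc ‖1 / (Complex.exp w - 1) - w * Complex.exp w / (Complex.exp w - 1) ^ 2‖
      ≤ 1 / ‖Complex.exp w - 1‖ + ‖w‖ * Real.exp x / ‖Complex.exp w - 1‖ ^ 2 := by
        refine (norm_sub_le _ _).trans_eq ?_
        rw [norm_div, norm_one, norm_div, norm_mul, norm_pow, hnorm]
    _ ≤ 1 / (Real.exp x / 2) + (x + 2) * Real.exp x / (Real.exp x / 2) ^ 2 := by gcongr
    _ = 10 * (2 / 5 * x + 1) * (Real.exp x)⁻¹ := by field_simp; ring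
    _ ≤ 10 * Real.exp (1 / 2 * x) * (Real.exp x)⁻¹ := by
        gcongr
        linarith [Real.add_one_le_exp (1 / 2 * x)]
    _ = 10 * Real.exp (-(1 / 2 * x)) := by
        rw [mul_assoc, ← Real.exp_neg, ← Real.exp_add]
        ring_nf

theorem exists_expBoundOn_desFun : ∃ M, ExpBoundOn (1 / 2) M 2 desFun := by
  have hK : IsCompact (Set.Icc (-2 : ℝ) 1 ×ℂ Set.Icc (-2 : ℝ) 2) :=
    isCompact_Icc.reProdIm isCompact_Icc
  have hsub : Set.Icc (-2 : ℝ) 1 ×ℂ Set.Icc (-2 : ℝ) 2 ⊆ {w : ℂ | |w.im| < 2 * Real.pi} :=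
    fun w hw => (abs_le.2 hw.2).trans_lt (by linarith [Real.pi_gt_three])
  obtain ⟨M, hM⟩ := hK.exists_bound_of_continuousOn (differentiableOn_desFun.continuousOn.mono hsub)
  refine ⟨max 10 (M * Real.exp (1 / 2)), fun w hw => ?_⟩
  rcases le_total 1 w.re with h | h
  · refine (norm_desFun_le_of_one_le_re h hw.2.le).trans ?_
    gcongr
    exact le_max_left _ _
  · have hle : ‖desFun w‖ ≤ M := hM w ⟨⟨hw.1.le, h⟩, abs_le.1 hw.2.le⟩
    calc ‖desFun w‖ ≤ M * Real.exp (1 / 2 + -(1 / 2 * w.re)) :=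
          hle.trans <| le_mul_of_one_le_right ((norm_nonneg _).trans hle) <|
            Real.one_le_exp_iff.2 (by linarith)
      _ = M * Real.exp (1 / 2) * Real.exp (-(1 / 2 * w.re)) := by rw [Real.exp_add, mul_assoc]
      _ ≤ _ := by
          gcongr
          exact le_max_right _ _

theorem isDecaying_desFun : IsDecaying 2 desFun :=
  ⟨differentiableOn_desFun.mono fun _ => abs_im_lt_of_mem_halfStrip,
    1 / 2, by norm_num, exists_expBoundOn_desFun⟩

theorem ofReal_mul_mem_halfStrip_two (hw : w ∈ halfStrip 1) (hl : l ∈ Set.Icc (1 / 2 : ℝ) (3 / 2)) :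
    (l : ℂ) * w ∈ halfStrip 2 := by
  constructor
  · rw [Complex.re_ofReal_mul]
    nlinarith [hw.1, hl.1, hl.2]
  · rw [Complex.im_ofReal_mul, abs_mul, abs_of_nonneg (by linarith [hl.1] : 0 ≤ l)]
    nlinarith [hw.2, hl.1, hl.2, abs_nonneg w.im]

theorem ExpBoundOn.norm_ofReal_mul_le {β M : ℝ} {f : ℂ → ℂ} (hf : ExpBoundOn β M 2 f) (hβ : 0 ≤ β)
    (hw : w ∈ halfStrip 1) (hl : l ∈ Set.Icc (1 / 2 : ℝ) (3 / 2)) :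
    ‖f (l * w)‖ ≤ M * Real.exp β * Real.exp (-(β / 2 * w.re)) := by
  have hre : 1 / 2 * w.re - 1 ≤ l * w.re := by
    rcases le_total 0 w.re with h | h
    · nlinarith [hl.1]
    · nlinarith [hl.2, hw.1]
  have hmem := ofReal_mul_mem_halfStrip_two hw hl
  refine (hf _ hmem).trans ?_
  rw [mul_assoc, ← Real.exp_add, Complex.re_ofReal_mul]
  refine mul_le_mul_of_nonneg_left (Real.exp_le_exp.2 ?_) (hf.nonneg hmem)
  nlinarith

theorem desQuotient_zero (hc : c ≠ 1) : desQuotient c 0 = desFun 0 := by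
  have hzero : HasDerivAt bernoulliGen (desFun 0) 0 :=
    hasDerivAt_bernoulliGen (by simp [Real.pi_pos])
  have hscaled : HasDerivAt (fun z : ℂ => bernoulliGen (c * z)) (desFun 0 * (c * 1)) 0 :=
    HasDerivAt.comp (h₂ := bernoulliGen) 0 (by rwa [mul_zero])
      ((hasDerivAt_id (0 : ℂ)).const_mul (c : ℂ))
  have hc' : (1 : ℂ) - c ≠ 0 := sub_ne_zero.2 (by exact_mod_cast hc.symm)
  rw [desQuotient, dslope_same, (hzero.fun_sub hscaled).deriv, div_eq_iff hc']
  ring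

theorem desQuotient_of_ne (hw : w ≠ 0) :
    desQuotient c w = (bernoulliGen w - bernoulliGen (c * w)) / w / (1 - c) := by
  simp only [desQuotient, dslope_of_ne _ hw, slope_def_field, mul_zero, sub_self, sub_zero]

theorem desQuotient_eq (hc : c ≠ 0) (hw : w ≠ 0) :
    desQuotient c w =
      (1 / (Complex.exp w - 1) - c / (Complex.exp (c * w) - 1)) / (1 - c) := by
  rw [desQuotient_of_ne hw, bernoulliGen_of_ne hw,
    bernoulliGen_of_ne (mul_ne_zero (Complex.ofReal_ne_zero.2 hc) hw), sub_div,
    div_div_cancel_left' hw, mul_div_right_comm, mul_div_cancel_right₀ _ hw, one_div]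

theorem norm_bernoulliGen_sub_le {M : ℝ} (hM : ExpBoundOn (1 / 2) M 2 desFun)
    (hc : c ∈ Set.Icc (1 / 2 : ℝ) (3 / 2)) (hw : w ∈ halfStrip 1) :
    ‖bernoulliGen w - bernoulliGen (c * w)‖ ≤
      M * Real.exp (1 / 2) * Real.exp (-(1 / 2 / 2 * w.re)) * ‖w - c * w‖ := by
  have hsegment : ∀ z ∈ segment ℝ ((c : ℂ) * w) w, ∃ l ∈ Set.Icc (1 / 2 : ℝ) (3 / 2),
      z = (l : ℂ) * w := by
    rintro z ⟨a, b, ha, hb, hab, rfl⟩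
    refine ⟨a * c + b, ⟨by nlinarith [hc.1], by nlinarith [hc.2]⟩, ?_⟩
    simp only [Complex.real_smul]
    push_cast
    ring
  refine (convex_segment ((c : ℂ) * w) w).norm_image_sub_le_of_norm_hasDerivWithin_le
    (𝕜 := ℂ) (f' := desFun) (fun z hz => ?_) (fun z hz => ?_)
    (left_mem_segment ℝ _ _) (right_mem_segment ℝ _ _) <;>
  obtain ⟨l, hl, rfl⟩ := hsegment z hz
  · exact (hasDerivAt_bernoulliGen
      (abs_im_lt_of_mem_halfStrip (ofReal_mul_mem_halfStrip_two hw hl))).hasDerivWithinAt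
  · exact hM.norm_ofReal_mul_le (by norm_num) hw hl

theorem exists_expBoundOn_desQuotient :
    ∃ M, ∀ c ∈ Set.Icc (1 / 2 : ℝ) (3 / 2), c ≠ 1 → ExpBoundOn (1 / 4) M 1 (desQuotient c) := by
  obtain ⟨M, hM⟩ := exists_expBoundOn_desFun
  refine ⟨M * Real.exp (1 / 2), fun c hc hc₁ w hw => ?_⟩
  rw [show (1 : ℝ) / 4 = 1 / 2 / 2 by norm_num]
  rcases eq_or_ne w 0 with rfl | hw₀
  · rw [desQuotient_zero hc₁]
    simpa using hM.norm_ofReal_mul_le (by norm_num) hw hc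
  · have hc' : (1 : ℂ) - c ≠ 0 := sub_ne_zero.2 (by exact_mod_cast hc₁.symm)
    rw [desQuotient_of_ne hw₀, div_div, norm_div,
      div_le_iff₀ (norm_pos_iff.2 (mul_ne_zero hw₀ hc')), mul_sub, mul_one, mul_comm w (c : ℂ)]
    exact norm_bernoulliGen_sub_le hM hc hw

theorem isDecaying_desQuotient (hc : c ∈ Set.Icc (1 / 2 : ℝ) (3 / 2)) (hc₁ : c ≠ 1) :
    IsDecaying 1 (desQuotient c) := by
  refine ⟨?_, 1 / 4, by norm_num,
    exists_expBoundOn_desQuotient.imp fun M hM => hM c hc hc₁⟩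
  have hnhds : halfStrip 1 ∈ 𝓝 (0 : ℂ) :=
    (isOpen_halfStrip 1).mem_nhds (by simp [halfStrip])
  refine ((Complex.differentiableOn_dslope hnhds).2 (DifferentiableOn.fun_sub ?_ ?_)).div_const _
  · exact differentiableOn_bernoulliGen.mono fun w hw =>
      abs_im_lt_of_mem_halfStrip (halfStrip_mono one_le_two hw)
  · exact differentiableOn_bernoulliGen.comp (by fun_prop) fun w hw =>
      abs_im_lt_of_mem_halfStrip (ofReal_mul_mem_halfStrip_two hw hc)

theorem tendsto_desQuotient (him : |w.im| < 2 * Real.pi) :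
    Tendsto (fun c : ℝ => desQuotient c w) (𝓝[≠] 1) (𝓝 (desFun w)) := by
  rcases eq_or_ne w 0 with rfl | hw
  · refine tendsto_const_nhds.congr' ?_
    filter_upwards [self_mem_nhdsWithin] with c hc using (desQuotient_zero hc).symm
  have hscaled : HasDerivAt (fun c : ℂ => bernoulliGen (c * w)) (desFun w * (1 * w)) 1 :=
    HasDerivAt.comp (h₂ := bernoulliGen) 1 (by rw [one_mul]; exact hasDerivAt_bernoulliGen him)
      ((hasDerivAt_id (1 : ℂ)).mul_const w)
  have hslope := (hasDerivAt_iff_tendsto_slope.1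
    (HasDerivAt.comp_ofReal (z := 1) (by simpa using hscaled))).div_const w
  rw [mul_div_cancel_right₀ _ hw] at hslope
  refine hslope.congr fun c => ?_
  rw [slope_def_module, desQuotient_of_ne hw, Complex.real_smul, Complex.ofReal_inv,
    Complex.ofReal_sub, Complex.ofReal_one, one_mul, ← neg_sub (1 : ℂ) c, inv_neg]
  ring

theorem exp_neg_log_add {t : ℝ} (ht : 0 < t) (y : ℂ) :
    Complex.exp ((-Real.log t : ℝ) + y) = 1 / (t : ℂ) * Complex.exp y := by
  rw [Complex.exp_add, ← Complex.ofReal_exp, Real.exp_neg, Real.exp_log ht]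
  simp

theorem desLiZero_eq_desFun {t : ℝ} (ht : t ∈ Set.Ioo (0 : ℝ) 1) :
    (desLiZero t : ℂ) = desFun (-Real.log t : ℝ) := by
  have hlog : ((-Real.log t : ℝ) : ℂ) ≠ 0 :=
    Complex.ofReal_ne_zero.2 (neg_ne_zero.2 (Real.log_neg ht.1 ht.2).ne)
  have ht₀ : (t : ℂ) ≠ 0 := by exact_mod_cast ht.1.ne'
  have ht₁ : (1 : ℂ) - t ≠ 0 := sub_ne_zero.2 (by exact_mod_cast ht.2.ne')
  have hexp : Complex.exp (-Real.log t : ℝ) = 1 / t := by simpa using exp_neg_log_add ht.1 0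
  have hsub : (1 : ℂ) / t - 1 = (1 - t) / t := by field_simp
  rw [desFun_of_ne hlog (by simp [Real.pi_pos]), hexp, hsub, desLiZero]
  push_cast
  field_simp
  ring

end GeneratingFunction

section IntegrationByParts

theorem hankelFactor_eq_mul_hankelFactor_add_one {s : ℂ} (hs : s ≠ 0) :
    hankelFactor s = s * hankelFactor (s + 1) := by
  have hΓ : Complex.Gamma (1 - s) = -s * Complex.Gamma (1 - (s + 1)) := by
    rw [show 1 - s = -s + 1 by ring, show 1 - (s + 1) = -s by ring,
      Complex.Gamma_add_one _ (neg_ne_zero.2 hs)]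
  have hexp : Complex.exp (-(Real.pi * Complex.I * (s + 1))) =
      -Complex.exp (-(Real.pi * Complex.I * s)) := by
    rw [mul_add, neg_add, Complex.exp_add, mul_one, Complex.exp_neg (Real.pi * Complex.I),
      Complex.exp_pi_mul_I, inv_neg_one, mul_neg_one]
  rw [hankelFactor, hankelFactor, hΓ, hexp]
  ring

variable {δ ε : ℝ} {f : ℂ → ℂ} {w s : ℂ}

theorem add_exp_ofReal_mem_halfStrip (hw : w ∈ halfStrip δ) (v : ℝ) :
    w + Complex.exp v ∈ halfStrip δ :=
  (isNearRay_rayPath le_rfl).add_mem (by rwa [sub_zero]) v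

namespace IsDecaying

theorem hasDerivAt_logIntegrand (hf : IsDecaying δ f) (s : ℂ) {z : ℂ}
    (hz : w + Complex.exp z ∈ halfStrip δ) :
    HasDerivAt (logIntegrand f w s)
      (logIntegrand (_root_.deriv f) w (s + 1) z + s * logIntegrand f w s z) z := by
  have hcomp := (hf.differentiableAt hz).hasDerivAt.comp z
    ((Complex.hasDerivAt_exp z).const_add w)
  refine (hcomp.mul ((hasDerivAt_id z).const_mul s).cexp).congr_deriv ?_
  simp only [logIntegrand, add_mul, one_mul, Complex.exp_add, Function.comp_apply, id]
  ring

theorem hasDerivAt_logIntegrand_ofReal (hf : IsDecaying δ f) (hw : w ∈ halfStrip δ) (s : ℂ)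
    (v : ℝ) :
    HasDerivAt (fun v : ℝ => logIntegrand f w s v)
      (logIntegrand (_root_.deriv f) w (s + 1) v + s * logIntegrand f w s v) v :=
  (hf.hasDerivAt_logIntegrand s (add_exp_ofReal_mem_halfStrip hw v)).comp_ofReal

theorem integrableOn_logIntegrand_deriv_Ioi (hf : IsDecaying δ f) (hw : w ∈ halfStrip δ)
    (s : ℂ) (c : ℝ) :
    IntegrableOn (fun v : ℝ => logIntegrand (_root_.deriv f) w s v) (Set.Ioi c) := by
  obtain ⟨η, hη, hwη⟩ := exists_pos_mem_halfStrip_sub hw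
  exact (hf.deriv hη).integrableOn_logIntegrand_Ioi hwη s c

theorem integrable_logIntegrand_deriv (hf : IsDecaying δ f) (hw : w ∈ halfStrip δ)
    (hs : 0 < s.re) : Integrable fun v : ℝ => logIntegrand (_root_.deriv f) w s v := by
  obtain ⟨η, hη, hwη⟩ := exists_pos_mem_halfStrip_sub hw
  exact (hf.deriv hη).integrable_logIntegrand hwη hs

theorem tendsto_logIntegrand_atTop (hf : IsDecaying δ f) (hw : w ∈ halfStrip δ) (s : ℂ) :
    Tendsto (fun v : ℝ => logIntegrand f w s v) atTop (𝓝 0) :=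
  tendsto_zero_of_hasDerivAt_of_integrableOn_Ioi (a := 0)
    (fun v _ => hf.hasDerivAt_logIntegrand_ofReal hw s v)
    ((hf.integrableOn_logIntegrand_deriv_Ioi hw (s + 1) 0).add
      ((hf.integrableOn_logIntegrand_Ioi hw s 0).const_mul s))
    (hf.integrableOn_logIntegrand_Ioi hw s 0)

theorem setIntegral_Ioi_logIntegrand_deriv (hf : IsDecaying δ f) (hw : w ∈ halfStrip δ)
    (s : ℂ) (c : ℝ) :
    ∫ v in Set.Ioi c, logIntegrand (_root_.deriv f) w (s + 1) (v : ℝ) =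
      -logIntegrand f w s c - s * ∫ v in Set.Ioi c, logIntegrand f w s (v : ℝ) := by
  have hint := hf.integrableOn_logIntegrand_deriv_Ioi hw (s + 1) c
  have hint' := (hf.integrableOn_logIntegrand_Ioi hw s c).const_mul s
  have hftc := integral_Ioi_of_hasDerivAt_of_tendsto'
    (fun v _ => hf.hasDerivAt_logIntegrand_ofReal hw s v) (hint.add hint')
    (hf.tendsto_logIntegrand_atTop hw s)
  rw [integral_add hint hint', integral_const_mul] at hftc
  linear_combination hftc

theorem continuous_circle_logIntegrand (hε : 0 < ε) (hf : IsDecaying δ f)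
    (hw : w ∈ halfStrip (δ - ε)) (s : ℂ) :
    Continuous fun θ : ℝ => logIntegrand f w s (Real.log ε + θ * Complex.I) :=
  continuous_iff_continuousAt.2 fun θ =>
    ContinuousAt.comp (f := fun θ : ℝ => (Real.log ε : ℂ) + θ * Complex.I)
      (hf.differentiableAt_logIntegrand
        (add_exp_mem_halfStrip hε hw (by simp))).continuousAt (by fun_prop)

theorem circle_logIntegrand_deriv (hε : 0 < ε) (hf : IsDecaying δ f)
    (hw : w ∈ halfStrip (δ - ε)) (s : ℂ) :
    Complex.I * (∫ θ in (0 : ℝ)..2 * Real.pi,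
        logIntegrand (_root_.deriv f) w (s + 1) (Real.log ε + θ * Complex.I)) =
      (Complex.exp (2 * Real.pi * Complex.I * s) - 1) * logIntegrand f w s (Real.log ε) -
        s * (Complex.I * ∫ θ in (0 : ℝ)..2 * Real.pi,
          logIntegrand f w s (Real.log ε + θ * Complex.I)) := by
  obtain ⟨η, hη, hwη⟩ := exists_pos_mem_halfStrip_sub hw
  rw [sub_right_comm] at hwη
  have hcont' := (hf.deriv hη).continuous_circle_logIntegrand hε hwη (s + 1)
  have hcont := (hf.continuous_circle_logIntegrand hε hw s).const_mul s
  have hderiv : ∀ θ : ℝ, HasDerivAt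
      (fun θ : ℝ => logIntegrand f w s (Real.log ε + θ * Complex.I))
      (Complex.I * (logIntegrand (_root_.deriv f) w (s + 1) (Real.log ε + θ * Complex.I) +
        s * logIntegrand f w s (Real.log ε + θ * Complex.I))) θ := fun θ => by
    have hline : HasDerivAt (fun θ : ℝ => (Real.log ε : ℂ) + θ * Complex.I) Complex.I θ := by
      simpa using (Complex.ofRealCLM.hasDerivAt.mul_const Complex.I).const_add (Real.log ε : ℂ)
    exact (hf.hasDerivAt_logIntegrand s (add_exp_mem_halfStrip hε hw (by simp))).scomp θ hline
  have hftc := intervalIntegral.integral_eq_sub_of_hasDerivAt (fun θ _ => hderiv θ)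
    (((hcont'.add hcont).const_mul Complex.I).intervalIntegrable 0 (2 * Real.pi))
  have hperiod := logIntegrand_add_two_pi_mul_I f w s (Real.log ε)
  rw [intervalIntegral.integral_const_mul, intervalIntegral.integral_add
    (hcont'.intervalIntegrable _ _) (hcont.intervalIntegrable _ _),
    intervalIntegral.integral_const_mul] at hftc
  push_cast at hftc
  rw [hperiod, zero_mul, add_zero] at hftc
  linear_combination hftc

theorem pathTransform_hankelDensity_deriv (hε : 0 < ε) (hf : IsDecaying δ f)
    (hw : w ∈ halfStrip (δ - ε)) (hs : s ≠ 0) :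
    _root_.pathTransform (hankelPath ε) (hankelDensity ε (s + 1)) (_root_.deriv f) w =
      -_root_.pathTransform (hankelPath ε) (hankelDensity ε s) f w := by
  obtain ⟨η, hη, hwη⟩ := exists_pos_mem_halfStrip_sub hw
  rw [sub_right_comm] at hwη
  have hexp : Complex.exp (2 * Real.pi * Complex.I * (s + 1)) =
      Complex.exp (2 * Real.pi * Complex.I * s) := by
    rw [mul_add, mul_one, Complex.exp_periodic]
  rw [(hf.deriv hη).pathTransform_hankelDensity hε hwη, hf.pathTransform_hankelDensity hε hw, hexp,
    hf.setIntegral_Ioi_logIntegrand_deriv (halfStrip_mono (by linarith) hw),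
    hf.circle_logIntegrand_deriv hε hw, hankelFactor_eq_mul_hankelFactor_add_one hs]
  ring

theorem pathTransform_hankelDensity_zero (hε : 0 < ε) (hf : IsDecaying δ f)
    (hw : w ∈ halfStrip (δ - ε)) :
    _root_.pathTransform (hankelPath ε) (hankelDensity ε 0) f w = f w := by
  have hsub : Metric.closedBall w ε ⊆ halfStrip δ := fun z hz => by
    have hnorm : ‖z - w‖ ≤ ε := mem_closedBall_iff_norm.1 hz
    simpa using add_mem_halfStrip hw (abs_le.1 ((Complex.abs_re_le_norm (z - w)).trans hnorm)).1
      ((Complex.abs_im_le_norm (z - w)).trans hnorm)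
  have hcauchy := ((hf.differentiableOn.mono hsub).diffContOnCl_ball
    le_rfl).circleIntegral_sub_inv_smul (Metric.mem_ball_self hε)
  have hcircle : (∮ z in C(w, ε), (z - w)⁻¹ • f z) = Complex.I * ∫ θ in (0 : ℝ)..2 * Real.pi,
      logIntegrand f w 0 (Real.log ε + θ * Complex.I) := by
    rw [circleIntegral, ← intervalIntegral.integral_const_mul]
    refine intervalIntegral.integral_congr fun θ _ => ?_
    have hne : circleMap 0 ε θ ≠ 0 := circleMap_ne_center hε.ne'
    have hpoint : Complex.exp (Real.log ε + θ * Complex.I) = circleMap 0 ε θ := by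
      rw [Complex.exp_add, ← Complex.ofReal_exp, Real.exp_log hε, circleMap_zero]
    have hcenter : circleMap w ε θ = w + circleMap 0 ε θ := by
      rw [← circleMap_sub_center w, add_sub_cancel]
    simp only [deriv_circleMap, circleMap_sub_center, smul_eq_mul, logIntegrand, hpoint, zero_mul,
      Complex.exp_zero, mul_one, ← hcenter]
    field_simp
  rw [hf.pathTransform_hankelDensity hε hw, ← hcircle, hcauchy, hankelFactor]
  simp only [sub_zero, Complex.Gamma_one, mul_zero, neg_zero, Complex.exp_zero, smul_eq_mul,
    sub_self, zero_mul, zero_add]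
  field_simp [Complex.two_pi_I_ne_zero]

theorem pathTransform_rayDensity_deriv (hf : IsDecaying δ f) (hw : w ∈ halfStrip δ)
    (hs : 0 < s.re) :
    _root_.pathTransform rayPath (rayDensity (s + 1)) (_root_.deriv f) w =
      -_root_.pathTransform rayPath (rayDensity s) f w := by
  have hs₁ : 0 < (s + 1).re := by
    rw [Complex.add_re, Complex.one_re]
    linarith
  have hs₀ : s ≠ 0 := by
    rintro rfl
    exact hs.ne' Complex.zero_re
  have hint := hf.integrable_logIntegrand_deriv hw hs₁
  have hint' := hf.integrable_logIntegrand hw hs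
  have hftc := integral_eq_zero_of_hasDerivAt_of_integrable
    (hf.hasDerivAt_logIntegrand_ofReal hw s) (hint.add (hint'.const_mul s)) hint'
  rw [integral_add hint (hint'.const_mul s), integral_const_mul] at hftc
  rw [pathTransform_rayDensity, pathTransform_rayDensity, eq_neg_of_add_eq_zero_left hftc,
    Complex.Gamma_add_one s hs₀]
  field_simp

theorem pathTransform_rayDensity_one_deriv (hf : IsDecaying δ f) (hw : w ∈ halfStrip δ) :
    _root_.pathTransform rayPath (rayDensity 1) (_root_.deriv f) w = -f w := by
  have hbot : Tendsto (fun v : ℝ => logIntegrand f w 0 v) atBot (𝓝 (f w)) := by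
    have hpath : Tendsto (fun v : ℝ => w + Complex.exp v) atBot (𝓝 w) := by
      simpa using ((Complex.continuous_ofReal.tendsto 0).comp Real.tendsto_exp_atBot).const_add w
    simpa [logIntegrand, Function.comp_def] using
      (hf.differentiableAt hw).continuousAt.tendsto.comp hpath
  have hftc := integral_of_hasDerivAt_of_tendsto
    (f' := fun v : ℝ => logIntegrand (_root_.deriv f) w 1 v)
    (fun v => by simpa using hf.hasDerivAt_logIntegrand_ofReal hw 0 v)
    (hf.integrable_logIntegrand_deriv hw (by simp)) hbot (hf.tendsto_logIntegrand_atTop hw 0)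
  rw [pathTransform_rayDensity, hftc, Complex.Gamma_one, inv_one, one_mul, zero_sub]

end IsDecaying

end IntegrationByParts

section MixedTransform

/-- A path computing the normalized transform with exponent `s`: the Hankel contour for
`Re s < 1`, where the contour density has no pole, and the positive ray otherwise. -/
noncomputable def mixedPath (ε : ℝ) (s : ℂ) : ℝ → ℂ :=
  if s.re < 1 then hankelPath ε else rayPath

/-- The density of the normalized transform with exponent `s` along `mixedPath ε s`. -/
noncomputable def mixedDensity (ε : ℝ) (s : ℂ) : ℝ → ℂ :=
  if s.re < 1 then hankelDensity ε s else rayDensity s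

variable {δ ε : ℝ} {f : ℂ → ℂ} {w s : ℂ}

theorem isWeightedPath_mixedDensity (hε : 0 < ε) (s : ℂ) :
    IsWeightedPath ε (mixedPath ε s) (mixedDensity ε s) := by
  unfold mixedPath mixedDensity
  split_ifs with hs
  · exact isWeightedPath_hankelDensity hε s
  · exact (isHolomorphicWeightAt_rayDensity hε.le (by linarith)).isWeightedPath

theorem ne_intCast_of_ne_zero (hs : s ≠ 0) (h₀ : 0 ≤ s.re) (h₁ : s.re < 1) (n : ℤ) : s ≠ n := by
  rintro rfl
  rw [Complex.intCast_re] at h₀ h₁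
  have hn : n = 0 := by
    have : 0 ≤ n := by exact_mod_cast h₀
    have : n < 1 := by exact_mod_cast h₁
    omega
  exact hs (by simp [hn])

theorem IsDecaying.pathTransform_mixedDensity_deriv (hε : 0 < ε) (hf : IsDecaying δ f)
    (hw : w ∈ halfStrip (δ - ε)) (s : ℂ) :
    _root_.pathTransform (mixedPath ε (s + 1)) (mixedDensity ε (s + 1)) (_root_.deriv f) w =
      -_root_.pathTransform (mixedPath ε s) (mixedDensity ε s) f w := by
  have hwδ : w ∈ halfStrip δ := halfStrip_mono (by linarith) hw
  have hre : (s + 1).re < 1 ↔ s.re < 0 := by simp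
  simp only [mixedPath, mixedDensity, hre]
  rcases lt_or_ge s.re 0 with hneg | hnonneg
  · have hs : s ≠ 0 := fun h => by simp [h] at hneg
    simp only [if_pos hneg, if_pos (hneg.trans one_pos)]
    exact hf.pathTransform_hankelDensity_deriv hε hw hs
  simp only [if_neg (not_lt.2 hnonneg)]
  rcases le_or_gt 1 s.re with hge | hlt
  · simp only [if_neg (not_lt.2 hge)]
    exact hf.pathTransform_rayDensity_deriv hwδ (one_pos.trans_le hge)
  simp only [if_pos hlt]
  rcases eq_or_ne s 0 with rfl | hs
  · rw [zero_add, hf.pathTransform_rayDensity_one_deriv hwδ,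
      hf.pathTransform_hankelDensity_zero hε hw]
  have hn : ∀ n : ℤ, s + 1 ≠ n := fun n h => ne_intCast_of_ne_zero hs hnonneg hlt (n - 1) <| by
    rw [Int.cast_sub, Int.cast_one, ← h, add_sub_cancel_right]
  obtain ⟨η, hη, hwη⟩ := exists_pos_mem_halfStrip_sub hw
  rw [sub_right_comm] at hwη
  rw [← (hf.deriv hη).pathTransform_hankelDensity_eq_rayDensity hε hwη
    (by simpa using by linarith) hn, hf.pathTransform_hankelDensity_deriv hε hw hs]

theorem IsDecaying.hasDerivAt_pathTransform_mixedDensity (hε : 0 < ε) (hf : IsDecaying δ f)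
    (hw : w ∈ halfStrip (δ - ε)) (s : ℂ) :
    HasDerivAt (_root_.pathTransform (mixedPath ε (s + 1)) (mixedDensity ε (s + 1)) f)
      (-_root_.pathTransform (mixedPath ε s) (mixedDensity ε s) f w) w := by
  rw [← hf.pathTransform_mixedDensity_deriv hε hw]
  exact hf.hasDerivAt_pathTransform (isWeightedPath_mixedDensity hε (s + 1)) hw

end MixedTransform

section Representation

/-- `L` is the restriction of `F` to the positive real axis in the coordinate `-log t`, in which `D`
becomes `-d/dw`. -/
def RepresentedBy (L : ℝ → ℝ) (F : ℂ → ℂ) : Prop :=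
  ∀ t ∈ Set.Ioo (0 : ℝ) 1, (L t : ℂ) = F (-Real.log t : ℝ)

theorem neg_log_mem_halfStrip {δ t : ℝ} (hδ : 0 < δ) (ht : t ∈ Set.Ioo (0 : ℝ) 1) :
    ((-Real.log t : ℝ) : ℂ) ∈ halfStrip δ :=
  ofReal_mem_halfStrip hδ (neg_nonneg.2 (Real.log_nonpos ht.1.le ht.2.le))

theorem IsDecaying.tendsto_ofReal_atTop {δ : ℝ} {F : ℂ → ℂ} (hF : IsDecaying δ F) (hδ : 0 < δ) :
    Tendsto (fun x : ℝ => F x) atTop (𝓝 0) := by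
  obtain ⟨β, hβ, M, hM⟩ := hF.exists_expBoundOn
  have hlim : Tendsto (fun x : ℝ => M * Real.exp (-(β * x))) atTop (𝓝 0) := by
    simpa using ((Real.tendsto_exp_neg_atTop_nhds_zero.comp
      (tendsto_id.const_mul_atTop hβ)).const_mul M)
  refine squeeze_zero_norm' ?_ hlim
  filter_upwards [eventually_ge_atTop 0] with x hx using hM x (ofReal_mem_halfStrip hδ hx)

namespace RepresentedBy

variable {δ t : ℝ} {L : ℝ → ℝ} {F F' : ℂ → ℂ}

theorem hasDerivAt_ofReal {d : ℂ} (h : RepresentedBy L F) (ht : t ∈ Set.Ioo (0 : ℝ) 1)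
    (hF : HasDerivAt F d (-Real.log t : ℝ)) : HasDerivAt (fun z => (L z : ℂ)) (-d / t) t := by
  have hlog : HasDerivAt (fun z : ℝ => ((-Real.log z : ℝ) : ℂ)) (-t⁻¹ : ℝ) t :=
    (Real.hasDerivAt_log ht.1.ne').neg.ofReal_comp
  refine ((hF.scomp t hlog).congr_deriv ?_).congr_of_eventuallyEq
    (eventually_of_mem (Ioo_mem_nhds ht.1 ht.2) h)
  rw [smul_eq_mul]
  push_cast
  ring

theorem differentiableAt (h : RepresentedBy L F) (ht : t ∈ Set.Ioo (0 : ℝ) 1)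
    (hF : DifferentiableAt ℂ F (-Real.log t : ℝ)) : DifferentiableAt ℝ L t :=
  (Complex.reCLM.hasFDerivAt.comp_hasDerivAt t
    (h.hasDerivAt_ofReal ht hF.hasDerivAt)).differentiableAt

theorem intervalIntegrable (h : RepresentedBy L F) (hF : IsDecaying δ F) (hδ : 0 < δ)
    (ht : t ∈ Set.Ioo (0 : ℝ) 1) : IntervalIntegrable (fun z => L z / z) volume 0 t := by
  obtain ⟨β, hβ, M, hM⟩ := hF.exists_expBoundOn
  have hsub : ∀ z ∈ Set.Ioc 0 t, z ∈ Set.Ioo (0 : ℝ) 1 := fun z hz => ⟨hz.1, hz.2.trans_lt ht.2⟩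
  have hpow : IntervalIntegrable (fun z : ℝ => M * z ^ (β - 1)) volume 0 t :=
    (intervalIntegral.intervalIntegrable_rpow' (by linarith)).const_mul M
  rw [intervalIntegrable_iff_integrableOn_Ioc_of_le ht.1.le] at hpow ⊢
  refine hpow.mono' (ContinuousOn.aestronglyMeasurable (fun z hz => ?_) measurableSet_Ioc)
    ((ae_restrict_iff' measurableSet_Ioc).2 (ae_of_all _ fun z hz => ?_))
  · have hdiff := h.differentiableAt (hsub z hz)
      (hF.differentiableAt (neg_log_mem_halfStrip hδ (hsub z hz)))
    exact (hdiff.continuousAt.div continuousAt_id hz.1.ne').continuousWithinAt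
  · have hbound := hM _ (neg_log_mem_halfStrip hδ (hsub z hz))
    rw [← h z (hsub z hz), Complex.norm_real, Complex.ofReal_re, mul_neg, neg_neg, mul_comm β,
      ← Real.rpow_def_of_pos hz.1] at hbound
    rwa [norm_div, Real.norm_of_nonneg hz.1.le, div_le_iff₀ hz.1, mul_assoc,
      ← Real.rpow_add_one hz.1.ne', sub_add_cancel]

theorem opD (h : RepresentedBy L F) (hF : ∀ w ∈ halfStrip δ, HasDerivAt F (-F' w) w)
    (hδ : 0 < δ) : RepresentedBy (opD L) F' := fun t ht => by
  have hderiv := hF _ (neg_log_mem_halfStrip hδ ht)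
  have heq := (h.differentiableAt ht hderiv.differentiableAt).hasDerivAt.ofReal_comp.unique
    (h.hasDerivAt_ofReal ht hderiv)
  have ht₀ : (t : ℂ) ≠ 0 := Complex.ofReal_ne_zero.2 ht.1.ne'
  rw [_root_.opD, Complex.ofReal_mul, heq, neg_neg, mul_div_cancel₀ _ ht₀]

theorem opJ (h : RepresentedBy L F) (hFd : IsDecaying δ F) (hF'd : IsDecaying δ F')
    (hF' : ∀ w ∈ halfStrip δ, HasDerivAt F' (-F w) w) (hδ : 0 < δ) :
    RepresentedBy (opJ L) F' := fun t ht => by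
  set Φ : ℝ → ℂ := fun z => F' (-Real.log z : ℝ)
  have hderiv : ∀ z ∈ Set.Ioo (0 : ℝ) 1, HasDerivAt Φ ((L z / z : ℝ) : ℂ) z := fun z hz => by
    have hlog : HasDerivAt (fun z : ℝ => ((-Real.log z : ℝ) : ℂ)) (-z⁻¹ : ℝ) z :=
      (Real.hasDerivAt_log hz.1.ne').neg.ofReal_comp
    refine ((hF' _ (neg_log_mem_halfStrip hδ hz)).scomp z hlog).congr_deriv ?_
    rw [← h z hz, smul_eq_mul]
    push_cast
    ring
  have hzero : Tendsto Φ (𝓝[>] 0) (𝓝 0) := (hF'd.tendsto_ofReal_atTop hδ).comp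
    (tendsto_neg_atBot_atTop.comp Real.tendsto_log_nhdsGT_zero)
  have hcont : Tendsto Φ (𝓝[<] t) (𝓝 (Φ t)) :=
    (hderiv t ht).continuousAt.tendsto.mono_left nhdsWithin_le_nhds
  have hint := h.intervalIntegrable hFd hδ ht
  have hftc := intervalIntegral.integral_eq_sub_of_hasDerivAt_of_tendsto ht.1
    (fun z hz => hderiv z ⟨hz.1, hz.2.trans ht.2⟩) ⟨hint.1.ofReal, hint.2.ofReal⟩ hzero hcont
  rw [_root_.opJ, ← intervalIntegral.integral_ofReal, hftc, sub_zero]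

theorem opJPow {W : ℤ → ℂ → ℂ} (h : RepresentedBy L (W 0)) (hWd : ∀ m, IsDecaying δ (W m))
    (hW : ∀ m, ∀ w ∈ halfStrip δ, HasDerivAt (W (m + 1)) (-W m w) w) (hδ : 0 < δ) (m : ℤ) :
    RepresentedBy (opJPow m L) (W m) := by
  have hneg : ∀ n : ℕ, ∀ w ∈ halfStrip δ, HasDerivAt (W (-n)) (-W (-(n + 1 : ℕ)) w) w :=
    fun n w hw => by
      have := hW (-(n + 1 : ℕ)) w hw
      rwa [show (-(n + 1 : ℕ) + 1 : ℤ) = -n by push_cast; ring] at this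
  cases m with
  | ofNat n =>
    induction n with
    | zero => exact h
    | succ n ih =>
      simp only [_root_.opJPow, Function.iterate_succ_apply'] at ih ⊢
      exact ih.opJ (hWd _) (hWd _) (hW n) hδ
  | negSucc n =>
    induction n with
    | zero => exact h.opD (hneg 0) hδ
    | succ n ih =>
      simp only [_root_.opJPow, Function.iterate_succ_apply'] at ih ⊢
      exact ih.opD (hneg (n + 1)) hδ

end RepresentedBy

end Representation

section DesingularizedPolylogarithm

/-- The nested integral of `desFun` along the paths `mixedPath`. It computes
`L^des(k₁, …, k_r)(t)` at `a = -log t` and `s = k`, and continues both contour integrals of the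
theorem to all exponents. -/
noncomputable def desNested {r : ℕ} (ε : ℝ) (s : Fin r → ℂ) (a : ℂ) : ℂ :=
  nestedIntegral desFun (fun k => mixedPath ε (s k)) (fun k => mixedDensity ε (s k)) a

variable {ε : ℝ} {r : ℕ}

theorem isDecaying_desFun_mul_desNested (hε : 0 < ε) (s : Fin r → ℂ) :
    IsDecaying (2 - r * ε) fun w => desFun w * desNested ε s w :=
  isDecaying_desFun.mul_nestedIntegral fun _ => isWeightedPath_mixedDensity hε _

theorem desNested_succ (hε : 0 < ε) (s : Fin (r + 1) → ℂ) {a : ℂ}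
    (ha : a ∈ halfStrip (2 - (r + 1 : ℕ) * ε)) :
    desNested ε s a = pathTransform (mixedPath ε (s (Fin.last r))) (mixedDensity ε (s (Fin.last r)))
      (fun w => desFun w * desNested ε (fun k => s k.castSucc) w) a :=
  isDecaying_desFun.nestedIntegral_succ (fun _ => isWeightedPath_mixedDensity hε _) ha

theorem isDecaying_desNested (hε : 0 < ε) (s : Fin (r + 1) → ℂ) :
    IsDecaying (2 - (r + 1 : ℕ) * ε) (desNested ε s) := by
  refine IsDecaying.congr ?_ fun a ha => desNested_succ hε s ha
  rw [sub_natCast_succ_mul]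
  exact (isDecaying_desFun_mul_desNested hε _).pathTransform (isWeightedPath_mixedDensity hε _)

theorem IsDecaying.representedBy_opJPow {δ : ℝ} {L : ℝ → ℝ} {f : ℂ → ℂ} (hε : 0 < ε)
    (hf : IsDecaying δ f) (hδ : 0 < δ - ε) (h : RepresentedBy L f) (m : ℤ) :
    RepresentedBy (opJPow m L) (_root_.pathTransform (mixedPath ε m) (mixedDensity ε m) f) := by
  refine RepresentedBy.opJPow
    (W := fun m => _root_.pathTransform (mixedPath ε m) (mixedDensity ε m) f) (fun t ht => ?_)
    (fun m => hf.pathTransform (isWeightedPath_mixedDensity hε _)) (fun m w hw => ?_) hδ m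
  · simp only [mixedPath, mixedDensity, Int.cast_zero, Complex.zero_re, zero_lt_one, if_true]
    rw [hf.pathTransform_hankelDensity_zero hε (neg_log_mem_halfStrip hδ ht), h t ht]
  · rw [Int.cast_add, Int.cast_one]
    exact hf.hasDerivAt_pathTransform_mixedDensity hε hw m

theorem representedBy_desLi (hε : 0 < ε) (hr : r * ε < 2) (k : Fin r → ℤ) :
    RepresentedBy (desLi r k) (desNested ε fun i => (k i : ℂ)) := by
  induction r with
  | zero => exact fun t _ => by simp [desLi, desNested, nestedIntegral_zero]
  | succ r ih =>
    have hδ : 0 < 2 - (r + 1 : ℕ) * ε := sub_pos.2 hr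
    have hprod : RepresentedBy (fun t => desLiZero t * desLi r (fun i => k i.castSucc) t)
        fun w => desFun w * desNested ε (fun i => (k i.castSucc : ℂ)) w := fun t ht => by
      push_cast at hr
      rw [Complex.ofReal_mul, desLiZero_eq_desFun ht, ih (by linarith) _ t ht]
    intro t ht
    rw [desNested_succ hε _ (neg_log_mem_halfStrip hδ ht)]
    rw [sub_natCast_succ_mul] at hδ
    exact (isDecaying_desFun_mul_desNested hε _).representedBy_opJPow hε hδ hprod _ t ht

theorem differentiableAt_desLi (k : Fin (r + 1) → ℤ) {t : ℝ} (ht : t ∈ Set.Ioo (0 : ℝ) 1) :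
    DifferentiableAt ℝ (desLi (r + 1) k) t := by
  obtain ⟨ε, hε, hr⟩ := exists_pos_mul_lt two_pos ((r + 1 : ℕ) : ℝ)
  exact (representedBy_desLi hε hr k).differentiableAt ht
    ((isDecaying_desNested hε _).differentiableAt (neg_log_mem_halfStrip (sub_pos.2 hr) ht))

theorem intervalIntegrable_desLi_div (k : Fin (r + 1) → ℤ) {t : ℝ} (ht : t ∈ Set.Ioo (0 : ℝ) 1) :
    IntervalIntegrable (fun z => desLi (r + 1) k z / z) volume 0 t := by
  obtain ⟨ε, hε, hr⟩ := exists_pos_mul_lt two_pos ((r + 1 : ℕ) : ℝ)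
  exact (representedBy_desLi hε hr k).intervalIntegrable (isDecaying_desNested hε _)
    (sub_pos.2 hr) ht

theorem tendsto_desLi (hε : 0 < ε) (hr : r * ε < 2) (k : Fin r → ℤ) :
    Tendsto (fun t => (desLi r k t : ℂ)) (𝓝[<] 1) (𝓝 (desNested ε (fun i => (k i : ℂ)) 0)) := by
  have hlog : Tendsto (fun t : ℝ => ((-Real.log t : ℝ) : ℂ)) (𝓝[<] 1) (𝓝 0) := by
    have hcont : ContinuousAt (fun t : ℝ => ((-Real.log t : ℝ) : ℂ)) 1 :=
      (Real.continuousAt_log one_ne_zero).neg.ofReal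
    simpa using hcont.tendsto.mono_left (nhdsWithin_le_nhds (s := Set.Iio 1))
  refine ((isDecaying_desFun.continuousAt_nestedIntegral
    (fun _ => isWeightedPath_mixedDensity hε _)
    (zero_mem_halfStrip (sub_pos.2 hr))).tendsto.comp hlog).congr' ?_
  filter_upwards [Ioo_mem_nhdsLT one_pos] with t ht using (representedBy_desLi hε hr k t ht).symm

end DesingularizedPolylogarithm

section Continuation

variable {ε : ℝ} {r : ℕ} {a : ℂ}

theorem exists_isHolomorphicWeightAt_eqOn_mixedDensity (hε : 0 < ε) (s₀ : ℂ) :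
    ∃ p κ, IsHolomorphicWeightAt ε p κ s₀ ∧ ∀ᶠ s in 𝓝 s₀, IsWeightedPath ε p (κ s) ∧
      ∀ δ f, IsDecaying δ f →
        Set.EqOn (pathTransform (mixedPath ε s) (mixedDensity ε s) f)
          (pathTransform p (κ s) f) (halfStrip (δ - ε)) := by
  rcases lt_or_ge s₀.re 1 with h₁ | h₁
  · refine ⟨hankelPath ε, hankelDensity ε, isHolomorphicWeightAt_hankelDensity hε h₁, ?_⟩
    filter_upwards [Complex.continuous_re.continuousAt.eventually_lt_const h₁] with s hs
    refine ⟨isWeightedPath_hankelDensity hε s, fun δ f _ w _ => ?_⟩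
    rw [mixedPath, mixedDensity, if_pos hs, if_pos hs]
  · have h₀ : 0 < s₀.re := one_pos.trans_le h₁
    refine ⟨rayPath, rayDensity, isHolomorphicWeightAt_rayDensity hε.le h₀, ?_⟩
    filter_upwards [Complex.continuous_re.continuousAt.eventually_const_lt h₀] with s hs
    refine ⟨(isHolomorphicWeightAt_rayDensity hε.le hs).isWeightedPath, fun δ f hf w hw => ?_⟩
    rw [mixedPath, mixedDensity]
    split_ifs with hs₁
    · have hs₀ : s ≠ 0 := fun h => hs.ne' (by rw [h, Complex.zero_re])
      exact hf.pathTransform_hankelDensity_eq_rayDensity hε hw hs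
        (ne_intCast_of_ne_zero hs₀ hs.le hs₁)
    · rfl

theorem differentiable_desNested (hε : 0 < ε) (ha : a ∈ halfStrip (2 - r * ε)) :
    Differentiable ℂ fun s : Fin r → ℂ => desNested ε s a := fun s₀ => by
  choose p κ hp hκ using fun k => exists_isHolomorphicWeightAt_eqOn_mixedDensity hε (s₀ k)
  refine (isDecaying_desFun.differentiableAt_nestedIntegral hp ha).congr_of_eventuallyEq ?_
  filter_upwards [eventually_all.2 fun k =>
    (continuous_apply k).continuousAt.eventually (hκ k)] with s hs
  exact isDecaying_desFun.nestedIntegral_congr (fun _ => isWeightedPath_mixedDensity hε _)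
    (fun k => (hs k).1) (fun k => (hs k).2) ha

end Continuation

section ContourIntegrals

variable {ε ε' c t : ℝ} {r : ℕ} {s : Fin r → ℂ}

theorem ae_hankelPath_ne (hε : 0 < ε) (z : ℂ) : ∀ᵐ u, hankelPath ε u ≠ z := by
  have hcircle : {u : ℝ | Complex.exp (Complex.I * u) = z / ε}.Countable :=
    (Set.countable_singleton (z / (ε : ℂ))).preimage_cexp.preimage (f := fun u : ℝ => Complex.I * u)
      ((mul_right_injective₀ Complex.I_ne_zero).comp Complex.ofReal_injective)
  have hsubset : {u : ℝ | hankelPath ε u = z} ⊆ insert (ε - z.re)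
      (insert (2 * Real.pi + z.re - ε) {u : ℝ | Complex.exp (Complex.I * u) = z / ε}) := by
    rintro u (rfl : hankelPath ε u = z)
    rcases lt_or_ge u 0 with h₀ | h₀
    · left
      rw [hankelPath_of_neg h₀, Complex.ofReal_re, sub_sub_cancel]
    rcases le_or_gt u (2 * Real.pi) with h₁ | h₁
    · right; right
      rw [hankelPath_of_mem_Icc h₀ h₁]
      exact (mul_div_cancel_left₀ _ (Complex.ofReal_ne_zero.2 hε.ne')).symm
    · right; left
      rw [hankelPath_of_gt h₁, Complex.ofReal_re]
      ring
  exact (((hcircle.insert _).insert _).mono hsubset).ae_notMem volume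

theorem ae_add_sum_Ici_hankelPath_ne_zero (hε : 0 < ε) (a : ℂ) :
    ∀ᵐ u : Fin r → ℝ, ∀ j, a + ∑ k ∈ Finset.Ici j, hankelPath ε (u k) ≠ 0 :=
  eventually_all.2 <| ae_add_sum_Ici_ne_zero (fun _ => continuous_hankelPath ε)
    (fun _ => ae_hankelPath_ne hε) a

theorem hankelIntegrand_hatKernel_ae_eq (hε : 0 < ε) (hr : r * ε < 2)
    (ht : t ∈ Set.Ioo (0 : ℝ) 1) (s : Fin r → ℂ) :
    hankelIntegrand (hatKernel r t) ε s =ᵐ[volume] nestedIntegrand desFun (fun _ => hankelPath ε)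
      (fun k => hankelWeight ε (s k)) (-Real.log t : ℝ) := by
  filter_upwards [ae_add_sum_Ici_hankelPath_ne_zero hε ((-Real.log t : ℝ) : ℂ)] with u hu
  have hmem := add_sum_mem_halfStrip (fun _ => isNearRay_hankelPath hε.le)
    (neg_log_mem_halfStrip (sub_pos.2 hr) ht)
  refine congrArg (· * _) (Finset.prod_congr rfl fun j _ => ?_)
  rw [desFun_of_ne (hu j) (abs_im_lt_of_mem_halfStrip (hmem _ u)), exp_neg_log_add ht.1]
  push_cast
  ring

theorem hankelIntegrand_desKernel_ae_eq (hε : 0 < ε) (hc : c ≠ 0) (hc₁ : c ≠ 1)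
    (s : Fin r → ℂ) :
    hankelIntegrand (desKernel r c) ε s =ᵐ[volume] fun u => (1 - (c : ℂ)) ^ r *
      nestedIntegrand (desQuotient c) (fun _ => hankelPath ε)
        (fun k => hankelWeight ε (s k)) 0 u := by
  have hc₁' : (1 : ℂ) - c ≠ 0 := sub_ne_zero.2 (by exact_mod_cast hc₁.symm)
  filter_upwards [ae_add_sum_Ici_hankelPath_ne_zero hε 0] with u hu
  rw [nestedIntegrand, ← mul_assoc, ← Fin.prod_const, ← Finset.prod_mul_distrib]
  refine congrArg (· * _) (Finset.prod_congr rfl fun j _ => ?_)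
  rw [desQuotient_eq hc (hu j), mul_div_cancel₀ _ hc₁', zero_add]

theorem hankelCoeff_mul_nestedIntegral (hs : NonIntegral s) (G : ℂ → ℂ) (p : Fin r → ℝ → ℂ)
    (a : ℂ) : hankelCoeff s * nestedIntegral G p (fun k => hankelWeight ε (s k)) a =
      nestedIntegral G p (fun k => hankelDensity ε (s k)) a := by
  have hcoeff : hankelCoeff s = ∏ k, hankelFactor (s k) :=
    Finset.prod_congr rfl fun k _ => (hankelFactor_eq (hs k)).symm
  rw [nestedIntegral, ← integral_const_mul, nestedIntegral]
  refine integral_congr_ae (ae_of_all _ fun u => ?_)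
  simp only [nestedIntegrand, hankelDensity]
  rw [Finset.prod_mul_distrib (f := fun k => hankelFactor (s k)), hcoeff, mul_left_comm]

theorem hankelCoeff_mul_hankelIntegral_hatKernel (hε : 0 < ε) (hr : r * ε < 2)
    (ht : t ∈ Set.Ioo (0 : ℝ) 1) (hs : NonIntegral s) :
    hankelCoeff s * hankelIntegral (hatKernel r t) ε s = nestedIntegral desFun
      (fun _ => hankelPath ε) (fun k => hankelDensity ε (s k)) (-Real.log t : ℝ) := by
  rw [← hankelCoeff_mul_nestedIntegral hs, hankelIntegral,
    integral_congr_ae (hankelIntegrand_hatKernel_ae_eq hε hr ht s), nestedIntegral]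

theorem hankelCoeff_mul_hankelIntegral_desKernel (hε : 0 < ε) (hc : c ≠ 0) (hc₁ : c ≠ 1)
    (hs : NonIntegral s) :
    1 / (1 - (c : ℂ)) ^ r * hankelCoeff s * hankelIntegral (desKernel r c) ε s =
      nestedIntegral (desQuotient c) (fun _ => hankelPath ε)
        (fun k => hankelDensity ε (s k)) 0 := by
  have hc₁' : (1 : ℂ) - c ≠ 0 := sub_ne_zero.2 (by exact_mod_cast hc₁.symm)
  rw [← hankelCoeff_mul_nestedIntegral hs, hankelIntegral,
    integral_congr_ae (hankelIntegrand_desKernel_ae_eq hε hc hc₁ s), integral_const_mul,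
    nestedIntegral]
  field_simp

theorem integrable_hankelIntegrand_hatKernel (hε : 0 < ε) (hr : r * ε < 2)
    (ht : t ∈ Set.Ioo (0 : ℝ) 1) (s : Fin r → ℂ) :
    Integrable (hankelIntegrand (hatKernel r t) ε s) :=
  (isDecaying_desFun.integrable_nestedIntegrand
    (fun k => (isHolomorphicWeightAt_hankelWeight hε (s k)).isWeightedPath)
    (neg_log_mem_halfStrip (sub_pos.2 hr) ht)).congr
    (hankelIntegrand_hatKernel_ae_eq hε hr ht s).symm

theorem integrable_hankelIntegrand_desKernel (hε : 0 < ε) (hr : r * ε < 1)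
    (hc : c ∈ Set.Icc (1 / 2 : ℝ) (3 / 2)) (hc₁ : c ≠ 1) (s : Fin r → ℂ) :
    Integrable (hankelIntegrand (desKernel r c) ε s) :=
  (((isDecaying_desQuotient hc hc₁).integrable_nestedIntegrand
    (fun k => (isHolomorphicWeightAt_hankelWeight hε (s k)).isWeightedPath)
    (zero_mem_halfStrip (sub_pos.2 hr))).const_mul _).congr
    (hankelIntegrand_desKernel_ae_eq hε (by linarith [hc.1]) hc₁ s).symm

theorem nestedIntegral_hankelDensity_eq_desNested (hs : NonIntegral s) (hε : 0 < ε) (hε' : 0 < ε')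
    (hr : r * ε < 2) (hr' : r * ε' < 2) {x : ℝ} (hx : 0 ≤ x) :
    nestedIntegral desFun (fun _ => hankelPath ε) (fun k => hankelDensity ε (s k)) x =
      desNested ε' s x := by
  have hmax : r * max ε ε' < 2 := by
    rw [mul_max_of_nonneg _ _ (Nat.cast_nonneg r)]
    exact max_lt hr hr'
  refine isDecaying_desFun.nestedIntegral_congr (ε := max ε ε')
    (fun _ => (isWeightedPath_hankelDensity hε _).mono (le_max_left _ _))
    (fun _ => (isWeightedPath_mixedDensity hε' _).mono (le_max_right _ _))
    (fun k δ f hf w hw => ?_) (ofReal_mem_halfStrip (sub_pos.2 hmax) hx)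
  rw [mixedPath, mixedDensity]
  split_ifs with hre
  · rcases le_total ε ε' with hle | hle
    · rw [max_eq_right hle] at hw
      exact (hf.pathTransform_hankelDensity_eq_of_le hε hle hw _).symm
    · rw [max_eq_left hle] at hw
      exact hf.pathTransform_hankelDensity_eq_of_le hε' hle hw _
  · exact hf.pathTransform_hankelDensity_eq_rayDensity hε
      (halfStrip_mono (sub_le_sub_left (le_max_left _ _) _) hw) (by linarith) (hs k)

theorem eventually_mem_Icc_and_ne_one :
    ∀ᶠ c : ℝ in 𝓝[≠] 1, c ∈ Set.Icc (1 / 2 : ℝ) (3 / 2) ∧ c ≠ 1 :=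
  Eventually.and (nhdsWithin_le_nhds (Icc_mem_nhds (by norm_num) (by norm_num)))
    self_mem_nhdsWithin

theorem tendsto_nestedIntegral_desQuotient {p κ : Fin r → ℝ → ℂ}
    (hp : ∀ k, IsWeightedPath ε (p k) (κ k)) (hr : r * ε < 1) :
    Tendsto (fun c : ℝ => nestedIntegral (desQuotient c) p κ 0) (𝓝[≠] 1)
      (𝓝 (nestedIntegral desFun p κ 0)) := by
  obtain ⟨M, hM⟩ := exists_expBoundOn_desQuotient
  choose C b hb hC using fun k => (hp k).exists_weight_le (1 / 4) (by norm_num)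
  have hray : ∀ k, IsNearRay ε (p k) := fun k => (hp k).toIsNearRay
  have h₀ : (0 : ℂ) ∈ halfStrip (1 - r * ε) := zero_mem_halfStrip (sub_pos.2 hr)
  refine tendsto_integral_filter_of_dominated_convergence
    (fun u => ∏ k, M * Real.exp (1 / 4 * 1) * (C k * Real.exp (-b k * |u k|))) ?_ ?_
    (integrable_prod_exp_neg_mul_abs C hb _) (ae_of_all _ fun u => ?_)
  · filter_upwards [eventually_mem_Icc_and_ne_one] with c hc
    exact (isDecaying_desQuotient hc.1 hc.2).aestronglyMeasurable_nestedIntegrand hray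
      (fun k => (hp k).measurable_weight) h₀
  · filter_upwards [eventually_mem_Icc_and_ne_one] with c hc
    exact ae_of_all _ fun u => norm_nestedIntegrand_le (by norm_num) (hM c hc.1 hc.2) hray
      (fun k => hC k (u k)) h₀
  · exact Tendsto.mul_const _ <| tendsto_finsetProd _ fun j _ => tendsto_desQuotient <|
      abs_im_lt_of_mem_halfStrip <| halfStrip_mono one_le_two <|
        add_sum_mem_halfStrip hray h₀ (Finset.Ici j) u

end ContourIntegrals

section EntireContinuations

variable {ε : ℝ} {r : ℕ}

theorem exists_pos_forall_mul_lt_one (r : ℕ) :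
    ∃ ε₀ > (0 : ℝ), ∀ ε ∈ Set.Ioo 0 ε₀, r * ε < 1 := by
  obtain ⟨ε₀, hε₀, hr⟩ := exists_pos_mul_lt one_pos (r : ℝ)
  exact ⟨ε₀, hε₀, fun ε hε =>
    (mul_le_mul_of_nonneg_left hε.2.le (Nat.cast_nonneg r)).trans_lt hr⟩

theorem isHatZetaDes_desNested (hε : 0 < ε) (hr : r * ε < 2) :
    IsHatZetaDes r fun t s => desNested ε s (-Real.log t : ℝ) := by
  obtain ⟨ε₀, hε₀, hsmall⟩ := exists_pos_forall_mul_lt_one r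
  refine ⟨fun t ht => differentiable_desNested hε (neg_log_mem_halfStrip (sub_pos.2 hr) ht),
    ε₀, hε₀, fun η hη t ht s hs => ?_⟩
  have hη_lt : r * η < 2 := (hsmall η hη).trans one_lt_two
  refine ⟨integrable_hankelIntegrand_hatKernel hη.1 hη_lt ht s, ?_⟩
  rw [hankelCoeff_mul_hankelIntegral_hatKernel hη.1 hη_lt ht hs,
    nestedIntegral_hankelDensity_eq_desNested hs hη.1 hε hη_lt hr
      (neg_nonneg.2 (Real.log_nonpos ht.1.le ht.2.le))]

theorem isZetaDes_desNested (hε : 0 < ε) (hr : r * ε < 2) :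
    IsZetaDes r fun s => desNested ε s 0 := by
  obtain ⟨ε₀, hε₀, hsmall⟩ := exists_pos_forall_mul_lt_one r
  refine ⟨differentiable_desNested hε (zero_mem_halfStrip (sub_pos.2 hr)), ε₀, hε₀,
    fun η hη s hs => ⟨?_, ?_⟩⟩
  · filter_upwards [eventually_mem_Icc_and_ne_one] with c hc
    exact integrable_hankelIntegrand_desKernel hη.1 (hsmall η hη) hc.1 hc.2 s
  · have hlim := tendsto_nestedIntegral_desQuotient
      (fun k => isWeightedPath_hankelDensity hη.1 (s k)) (hsmall η hη)
    have hlim_eq := nestedIntegral_hankelDensity_eq_desNested hs hη.1 hε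
      ((hsmall η hη).trans one_lt_two) hr (le_refl 0)
    rw [Complex.ofReal_zero] at hlim_eq
    rw [hlim_eq] at hlim
    refine hlim.congr' ?_
    filter_upwards [eventually_mem_Icc_and_ne_one] with c hc
    exact (hankelCoeff_mul_hankelIntegral_desKernel hη.1 (by linarith [hc.1.1]) hc.2 hs).symm

theorem dense_nonIntegral (r : ℕ) : Dense {s : Fin r → ℂ | NonIntegral s} := by
  have hdense : Dense (Set.range ((↑) : ℤ → ℂ))ᶜ := (Set.countable_range _).dense_compl ℝ
  refine (dense_pi Set.univ fun (_ : Fin r) _ => hdense).mono fun s hs k n hn => ?_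
  exact hs k (Set.mem_univ k) ⟨n, hn.symm⟩

theorem IsHatZetaDes.eqOn {F F' : ℝ → (Fin r → ℂ) → ℂ} (hF : IsHatZetaDes r F)
    (hF' : IsHatZetaDes r F') : Set.EqOn F F' (Set.Ioo 0 1) := fun t ht => by
  obtain ⟨hd, ε₀, hε₀, hF⟩ := hF
  obtain ⟨hd', ε₁, hε₁, hF'⟩ := hF'
  obtain ⟨ε, hε, hlt⟩ := exists_between (lt_min hε₀ hε₁)
  rw [lt_min_iff] at hlt
  refine (hd t ht).continuous.ext_on (dense_nonIntegral r) (hd' t ht).continuous fun s hs => ?_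
  rw [(hF ε ⟨hε, hlt.1⟩ t ht s hs).2, (hF' ε ⟨hε, hlt.2⟩ t ht s hs).2]

theorem IsZetaDes.unique {Z Z' : (Fin r → ℂ) → ℂ} (hZ : IsZetaDes r Z) (hZ' : IsZetaDes r Z') :
    Z = Z' := by
  obtain ⟨hd, ε₀, hε₀, hZ⟩ := hZ
  obtain ⟨hd', ε₁, hε₁, hZ'⟩ := hZ'
  obtain ⟨ε, hε, hlt⟩ := exists_between (lt_min hε₀ hε₁)
  rw [lt_min_iff] at hlt
  exact hd.continuous.ext_on (dense_nonIntegral r) hd'.continuous fun s hs =>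
    tendsto_nhds_unique (hZ ε ⟨hε, hlt.1⟩ s hs).2 (hZ' ε ⟨hε, hlt.2⟩ s hs).2

end EntireContinuations

/-- The first two conjuncts and the third one say that the objects are well defined: the entire
continuations exist, and all functions that occur in the iterated integrals are differentiable on
`(0,1)` and integrable against `dz / z` near `0`. -/
theorem mainTheorem2 (r : ℕ) (hr : 1 ≤ r) :
    IsHatZetaDes r (hatZetaDes r) ∧
    IsZetaDes r (zetaDes r) ∧
    ∀ k : Fin r → ℤ,
      (∀ t ∈ Set.Ioo (0 : ℝ) 1,
        DifferentiableAt ℝ (desLi r k) t ∧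
        IntervalIntegrable (fun z => desLi r k z / z) volume 0 t) ∧
      (∀ t ∈ Set.Ioo (0 : ℝ) 1,
        hatZetaDes r t (fun i => (k i : ℂ)) = (desLi r k t : ℂ)) ∧
      Tendsto (fun t : ℝ => (desLi r k t : ℂ)) (𝓝[<] 1)
        (𝓝 (zetaDes r (fun i => (k i : ℂ)))) := by
  obtain ⟨ε, hε, hrε⟩ := exists_pos_mul_lt two_pos (r : ℝ)
  have hHat := isHatZetaDes_desNested hε hrε
  have hZeta := isZetaDes_desNested hε hrε
  have hHatDes : IsHatZetaDes r (hatZetaDes r) := Classical.epsilon_spec ⟨_, hHat⟩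
  have hZetaDes : IsZetaDes r (zetaDes r) := Classical.epsilon_spec ⟨_, hZeta⟩
  refine ⟨hHatDes, hZetaDes, fun k => ⟨fun t ht => ?_, fun t ht => ?_, ?_⟩⟩
  · obtain ⟨n, rfl⟩ := Nat.exists_eq_add_of_le' hr
    exact ⟨differentiableAt_desLi k ht, intervalIntegrable_desLi_div k ht⟩
  · rw [hHatDes.eqOn hHat ht, representedBy_desLi hε hrε k t ht]
  · rw [hZetaDes.unique hZeta]
    exact tendsto_desLi hε hrε k
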